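/- Let $d\ge 2$ and let $G$ be a probability measure on $\mathbb R$ such that, for some $b>a>0$ and $\alpha>0$, $G$ is supported on $[a,b]$ and is absolutely continuous with a density $\rho$ satisfying $\rho(x)\ge\alpha$ for almost every $x\in[a,b]$. Let $E(\mathbb Z^d)$ be the set of nearest-neighbour edges of $\mathbb Z^d$, let $(t_e)_{e\in E(\mathbb Z^d)}$ be independent random variables with common law $G$, and let $T(p)=\sum_{e\in p}t_e$ for a finite lattice path $p$. For $v\in\mathbb Z^d$ let $\gamma(0,v)$ be the (almost surely unique) path from $0$ to $v$ minimizing $T$, and let $p_e:=\mathbb P(e\in\gamma(0,v))$. Write $\|\cdot\|$ for the Euclidean norm and $\|e-e'\|$ for the Euclidean distance between the centers of the edges $e$ and $e'$. Then there exist constants $C$ and $n_0$, depending only on $G$ and $d$, such that the following holds for every $v\in\mathbb Z^d$ with $n:=\|v\|\ge n_0$. If $q:E(\mathbb Z^d)\to[0,\infty)$ satisfies $$\tfrac1{10}\,q_{e'}\le q_e\le 10\,q_{e'}\qquad\text{for all } e,e'\in E(\mathbb Z^d)\text{ with }\|e-e'\|\le 2\log n,$$ then $$\Big(\sum_{e\in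 E(\mathbb Z^d)}q_ep_e\Big)^d\le C\Big(\sum_{e\in E(\mathbb Z^d)}q_e^2\Big)^{\frac{d-1}{2}}\sum_{e\in E(\mathbb Z^d)}q_e ,$$ where the sums are taken in $[0,\infty]$. -/

import Mathlib

open scoped NNReal ENNReal
open MeasureTheory ProbabilityTheory

namespace FPP

/-- The hypercubic lattice: vertices `ℤ^d`, edges between points at `ℓ¹` distance one. -/
def lattice (d : ℕ) : SimpleGraph (Fin d → ℤ) where
  Adj x y := ∑ i, |x i - y i| = 1
  symm := ⟨fun x y h => by simpa only [abs_sub_comm] using h⟩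
  loopless := ⟨fun x h => by simp at h⟩

/-- The edge set `E(ℤ^d)`. -/
abbrev Edge (d : ℕ) : Type := (lattice d).edgeSet

/-- The inclusion of `ℤ^d` in `ℝ^d`, the latter with its Euclidean norm. -/
noncomputable def toEuclid {d : ℕ} (x : Fin d → ℤ) : EuclideanSpace ℝ (Fin d) :=
  WithLp.toLp 2 fun i => (x i : ℝ)

/-- The midpoint of an (unordered) pair of lattice points, in `ℝ^d`. -/
noncomputable def center {d : ℕ} : Sym2 (Fin d → ℤ) → EuclideanSpace ℝ (Fin d) :=
  Sym2.lift ⟨fun x y => (2 : ℝ)⁻¹ • (toEuclid x + toEuclid y),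
    fun x y => by simp only [add_comm]⟩

/-- The Euclidean distance `‖e - e'‖` between the centers of two edges. -/
noncomputable def edgeDist {d : ℕ} (e e' : Edge d) : ℝ :=
  dist (center (e : Sym2 (Fin d → ℤ))) (center (e' : Sym2 (Fin d → ℤ)))

/-- The passage time `T(p) = ∑_{e ∈ p} t_e` of a finite lattice path `p` in the environment `t`. -/
noncomputable def passageTime {d : ℕ} (t : Edge d → ℝ) {x y : Fin d → ℤ}
    (p : (lattice d).Walk x y) : ℝ :=
  (p.darts.map fun a => t ⟨a.edge, a.edge_mem⟩).sum

/-- A geodesic from `x` to `y` is a finite path from `x` to `y` whose passage time is least among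
all such paths, that is, a path attaining the infimum `T(x, y)`. -/
def IsGeodesic {d : ℕ} (t : Edge d → ℝ) {x y : Fin d → ℤ} (p : (lattice d).Walk x y) : Prop :=
  ∀ p' : (lattice d).Walk x y, passageTime t p ≤ passageTime t p'

/-- The set of edges of the geodesic `γ(x, y)`. For independent weights with an atomless common
law on the positive reals there is almost surely exactly one geodesic from `x` to `y`, and this is
then its set of edges. -/
def geodesicEdges {d : ℕ} (t : Edge d → ℝ) (x y : Fin d → ℤ) : Set (Edge d) :=
  {e | ∃ p : (lattice d).Walk x y, IsGeodesic t p ∧ (e : Sym2 (Fin d → ℤ)) ∈ p.edges}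

/-- The assumption on the weight distribution: for some `b > a > 0` and `α > 0`, the law `G` is
supported on `[a, b]` and has a density with respect to Lebesgue measure that is at least `α`
almost everywhere on `[a, b]`. -/
def IsAdmissible (G : Measure ℝ) : Prop :=
  ∃ a b α : ℝ, 0 < a ∧ a < b ∧ 0 < α ∧ G (Set.Icc a b)ᶜ = 0 ∧
    ∃ ρ : ℝ → ℝ≥0∞, Measurable ρ ∧ G = (volume : Measure ℝ).withDensity ρ ∧
      ∀ᵐ x ∂(volume : Measure ℝ), x ∈ Set.Icc a b → ENNReal.ofReal α ≤ ρ x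

/-- The environment: `t_e`, for `e ∈ E(ℤ^d)`, are independent random variables on `(Ω, P)` with
common law `G`. -/
structure IsIIDEnvironment {d : ℕ} {Ω : Type*} [MeasurableSpace Ω] (P : Measure Ω)
    (t : Edge d → Ω → ℝ) (G : Measure ℝ) : Prop where
  hasLaw : ∀ e, HasLaw (t e) G P
  indep : iIndepFun t P

/-- The probability `p_e = P(e ∈ γ(0, v))`, as an element of `[0, ∞]`. -/
noncomputable def geodesicProb {d : ℕ} {Ω : Type*} [MeasurableSpace Ω] (P : Measure Ω)
    (t : Edge d → Ω → ℝ) (v : Fin d → ℤ) (e : Edge d) : ℝ≥0∞ :=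
  P {ω | e ∈ geodesicEdges (fun e' => t e' ω) 0 v}

/-- Smoothness of `q` in the logarithmic scale: `0.1 ≤ q_e / q_{e'} ≤ 10` whenever
`‖e - e'‖ ≤ 2 log n`, written without division. -/
def IsLogSmooth {d : ℕ} (n : ℝ) (q : Edge d → ℝ≥0) : Prop :=
  ∀ e e' : Edge d, edgeDist e e' ≤ 2 * Real.log n →
    (1 / 10) * q e' ≤ q e ∧ q e ≤ 10 * q e'

end FPP

/-!
Increase the weights slightly, by about `τ e = c * q e` on the edge `e`. If `∑ τ e ^ 2` is bounded
then the law of the environment changes by a density with a bounded third moment, so the geodesic of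
the increased environment is typical. Outside a negligible event, at least half of the edges of any
stretch of the geodesic of logarithmic length have a genuine gain, and `q` is nearly constant along
the stretch. So if the geodesic has `q`-weight at least `s`, the increase raises the passage time
from `0` to `v` by a multiple of `s`. No geodesic between endpoints within a small multiple of `s`
of `0` and `v` can gain much less, so in the original environment all geodesics from `u` to `v + u`,
with `|u|` up to a multiple of `s`, have `q`-weight of order `s`. Averaging over these `u`, since a
geodesic meets at most a multiple of `s` of the `s ^ d` translates of an edge, the probability of
this event is at most a multiple of `s ^ (- d) * ∑ q e`. This is a weak `L^d` bound, hence a weak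
`L^2` bound, for the `q`-weight of the geodesic of the increased environment, and the third moment
of the density turns it into a bound for the mean in the original environment.
-/

namespace FPP

section Transport

variable {X : Type*} [MeasurableSpace X]

/-- A change of variables `T` which transports the measure `W μ`, equivalent to `μ`, back to `μ`: in
other words, the law of `T` under `μ` is equivalent to `μ`, and expectations under `μ` are
expectations along `T` weighted by the density `W`. -/
structure IsDensityTransport (μ : Measure X) (T : X → X) (W : X → ℝ≥0∞) : Prop where
  measurable_map : Measurable T
  measurable_density : Measurable W
  density_ne_zero : ∀ x, W x ≠ 0
  map_withDensity : (μ.withDensity W).map T = μ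

namespace IsDensityTransport

variable {μ : Measure X} {T : X → X} {W : X → ℝ≥0∞}

lemma lintegral_mul_comp (h : IsDensityTransport μ T W) {f : X → ℝ≥0∞} (hf : Measurable f) :
    ∫⁻ x, W x * f (T x) ∂μ = ∫⁻ x, f x ∂μ := by
  conv_rhs => rw [← h.map_withDensity, lintegral_map hf h.measurable_map,
    lintegral_withDensity_eq_lintegral_mul _ h.measurable_density (g := fun x => f (T x))
      (hf.comp h.measurable_map)]
  rfl

lemma lintegral_density (h : IsDensityTransport μ T W) : ∫⁻ x, W x ∂μ = μ Set.univ := by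
  simpa using h.lintegral_mul_comp measurable_one

lemma ae_comp (h : IsDensityTransport μ T W) {p : X → Prop} (hp : ∀ᵐ x ∂μ, p x) :
    ∀ᵐ x ∂μ, p (T x) := by
  rw [← h.map_withDensity] at hp
  exact (withDensity_absolutelyContinuous' h.measurable_density.aemeasurable
    (.of_forall h.density_ne_zero)).ae_le (ae_of_ae_map h.measurable_map.aemeasurable hp)

end IsDensityTransport

end Transport

section InfiniteProduct

variable {ι : Type*} {X : ι → Type*} [∀ i, MeasurableSpace (X i)] {μ : ∀ i, Measure (X i)}
  [∀ i, IsProbabilityMeasure (μ i)]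

lemma lintegral_prod_infinitePi {f : ∀ i, X i → ℝ≥0∞} (hf : ∀ i, Measurable (f i)) (s : Finset ι) :
    ∫⁻ x, ∏ i ∈ s, f i (x i) ∂Measure.infinitePi μ = ∏ i ∈ s, ∫⁻ t, f i t ∂μ i := by
  rw [lintegral_prod_eq_prod_lintegral_of_indepFun s _ (iIndepFun_infinitePi hf) (by fun_prop)]
  refine Finset.prod_congr rfl fun i _ => ?_
  rw [← Measure.infinitePi_map_eval μ i, lintegral_map (hf i) (measurable_pi_apply i)]

lemma withDensity_prod_infinitePi {w : ∀ i, X i → ℝ≥0∞} (hw : ∀ i, Measurable (w i))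
    (hw1 : ∀ i, ∫⁻ t, w i t ∂μ i = 1) {s : Finset ι} (hs : ∀ i ∉ s, w i = 1) :
    (Measure.infinitePi μ).withDensity (fun x => ∏ i ∈ s, w i (x i)) =
      Measure.infinitePi fun i => (μ i).withDensity (w i) := by
  classical
  have hprob : ∀ i, IsProbabilityMeasure ((μ i).withDensity (w i)) := fun i =>
    ⟨by rw [withDensity_apply _ .univ, setLIntegral_univ, hw1]⟩
  refine Measure.eq_infinitePi _ fun u B hB => ?_
  set f : ∀ i, X i → ℝ≥0∞ := fun i => if i ∈ u then (B i).indicator (w i) else w i with hf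
  have hfm : ∀ i, Measurable (f i) := fun i => by
    simp only [hf]; split_ifs
    exacts [(hw i).indicator (hB i), hw i]
  have hbox : MeasurableSet ((u : Set ι).pi B) := .pi u.countable_toSet fun _ _ => hB _
  have hprod : ∀ x, ((u : Set ι).pi B).indicator (fun x => ∏ i ∈ s, w i (x i)) x =
      ∏ i ∈ s ∪ u, f i (x i) := by
    intro x
    by_cases hx : x ∈ (u : Set ι).pi B
    · have hfx : ∀ i, f i (x i) = w i (x i) := fun i => by
        by_cases hi : i ∈ u
        · simp [hf, hi, hx i hi]
        · simp [hf, hi]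
      rw [Set.indicator_of_mem hx]
      simp only [hfx]
      exact Finset.prod_subset Finset.subset_union_left fun i _ hi => by simp [hs i hi]
    · obtain ⟨i, hi, hxi⟩ : ∃ i ∈ u, x i ∉ B i := by simpa [Set.mem_pi] using hx
      rw [Set.indicator_of_notMem hx,
        Finset.prod_eq_zero (Finset.mem_union_right s hi) (by simp [hf, hi, hxi])]
  rw [withDensity_apply _ hbox, ← lintegral_indicator hbox, lintegral_congr hprod,
    lintegral_prod_infinitePi hfm,
    ← Finset.prod_subset Finset.subset_union_right fun i _ hi => by simp [hf, hi, hw1]]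
  refine Finset.prod_congr rfl fun i hi => ?_
  simp [hf, hi, lintegral_indicator (hB i), withDensity_apply _ (hB i)]

theorem IsDensityTransport.infinitePi {φ : ∀ i, X i → X i} {w : ∀ i, X i → ℝ≥0∞}
    (h : ∀ i, IsDensityTransport (μ i) (φ i) (w i)) {s : Finset ι} (hs : ∀ i ∉ s, w i = 1) :
    IsDensityTransport (Measure.infinitePi μ) (fun x i => φ i (x i))
      (fun x => ∏ i ∈ s, w i (x i)) where
  measurable_map := measurable_pi_iff.2 fun i =>
    (h i).measurable_map.comp (measurable_pi_apply i)
  measurable_density := Finset.measurable_fun_prod _ fun i _ =>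
    (h i).measurable_density.comp (measurable_pi_apply i)
  density_ne_zero x := Finset.prod_ne_zero_iff.2 fun i _ => (h i).density_ne_zero _
  map_withDensity := by
    have hw1 : ∀ i, ∫⁻ t, w i t ∂μ i = 1 := fun i => by rw [(h i).lintegral_density, measure_univ]
    have hprob : ∀ i, IsProbabilityMeasure ((μ i).withDensity (w i)) := fun i =>
      ⟨by rw [withDensity_apply _ .univ, setLIntegral_univ, hw1]⟩
    rw [withDensity_prod_infinitePi (fun i => (h i).measurable_density) hw1 hs,
      Measure.infinitePi_map_pi _ fun i => (h i).measurable_map]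
    simp only [(h _).map_withDensity]

lemma ae_infinitePi_of_ae {p : ∀ i, X i → Prop} [Countable ι] (hp : ∀ i, ∀ᵐ t ∂μ i, p i t) :
    ∀ᵐ x ∂Measure.infinitePi μ, ∀ i, p i (x i) :=
  ae_all_iff.2 fun i => ae_of_ae_map (measurable_pi_apply i).aemeasurable <| by
    rw [Measure.infinitePi_map_eval]; exact hp i

variable [DecidableEq ι]

lemma map_update_infinitePi (i : ι) :
    ((Measure.infinitePi μ).prod (μ i)).map (fun z => Function.update z.1 i z.2) =
      Measure.infinitePi μ := by
  refine Measure.eq_infinitePi _ fun s B hB => ?_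
  have hpre : (fun z : (∀ j, X j) × X i => Function.update z.1 i z.2) ⁻¹' (s : Set ι).pi B =
      ((s.erase i : Finset ι) : Set ι).pi B ×ˢ (if i ∈ s then B i else Set.univ) := by
    ext z
    simp only [Set.mem_preimage, Set.mem_pi, Finset.mem_coe, Set.mem_prod, Finset.mem_erase]
    constructor
    · refine fun h => ⟨fun j hj => by simpa [hj.1] using h j hj.2, ?_⟩
      split_ifs with hi
      · simpa using h i hi
      · trivial
    · rintro ⟨h1, h2⟩ j hj
      rcases eq_or_ne j i with rfl | h
      · simpa [hj] using h2
      · simpa [h] using h1 j ⟨h, hj⟩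
  rw [Measure.map_apply (by fun_prop) (.pi s.countable_toSet fun _ _ => hB _), hpre,
    Measure.prod_prod, Measure.infinitePi_pi _ fun j _ => hB j]
  split_ifs with hi
  · rw [mul_comm, Finset.mul_prod_erase s (fun j => μ j (B j)) hi]
  · rw [measure_univ, mul_one, Finset.erase_eq_of_notMem hi]

lemma ae_infinitePi_of_forall_ae_update (i : ι) {p : (∀ j, X j) → Prop}
    (hp : MeasurableSet {x | p x}) (h : ∀ x, ∀ᵐ t ∂μ i, p (Function.update x i t)) :
    ∀ᵐ x ∂Measure.infinitePi μ, p x := by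
  rw [← map_update_infinitePi i, ae_map_iff (by fun_prop) hp]
  exact (Measure.ae_prod_iff_ae_ae (p := fun z => p (Function.update z.1 i z.2))
    (hp.preimage (by fun_prop))).2 (.of_forall h)

end InfiniteProduct

lemma exists_measure_compl_le {Ω : Type*} [MeasurableSpace Ω] {μ : Measure Ω} [IsFiniteMeasure μ]
    {S : ℕ → Set Ω} (hS : ∀ k, MeasurableSet (S k)) (hmono : Monotone S)
    (hae : ∀ᵐ ω ∂μ, ∃ k, ω ∈ S k) {ε : ℝ≥0∞} (hε : 0 < ε) : ∃ k, μ (S k)ᶜ ≤ ε := by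
  have hlim := tendsto_measure_iInter_atTop (μ := μ) (fun k => (hS k).compl.nullMeasurableSet)
    (fun _ _ h => Set.compl_subset_compl.2 (hmono h)) ⟨0, measure_ne_top _ _⟩
  have hnull : μ (⋂ k, (S k)ᶜ) = 0 := by
    rw [← Set.compl_iUnion]
    exact hae.mono fun _ => Set.mem_iUnion.2
  rw [hnull] at hlim
  exact (hlim.eventually_le_const hε).exists

section Cdf

variable {G : Measure ℝ}

lemma cdf_mem_Icc (t : ℝ) : cdf G t ∈ Set.Icc (0 : ℝ) 1 := ⟨cdf_nonneg G t, cdf_le_one G t⟩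

lemma ae_exists_cdf_sub_le (hG : G ≪ volume) :
    ∀ᵐ t ∂G, ∃ K : ℕ, ∀ h, 0 ≤ h → cdf G (t + h) - cdf G t ≤ K * h := by
  filter_upwards [hG.ae_le (monotone_cdf G).ae_differentiableAt] with t ht
  obtain ⟨C, hC⟩ := ht.hasDerivAt.isBigO_sub.bound
  obtain ⟨δ, hδ, hbound⟩ := Metric.eventually_nhds_iff.1 hC
  obtain ⟨K, hK⟩ := exists_nat_ge (max C (1 / δ))
  refine ⟨K, fun h hh => ?_⟩
  rcases lt_or_ge h δ with hlt | hge
  · have hb := hbound (y := t + h) (by simpa [Real.dist_eq, abs_of_nonneg hh] using hlt)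
    rw [add_sub_cancel_left, Real.norm_eq_abs, Real.norm_eq_abs, abs_of_nonneg hh] at hb
    exact (le_abs_self _).trans (hb.trans (by gcongr; exact (le_max_left _ _).trans hK))
  · calc cdf G (t + h) - cdf G t ≤ 1 := by linarith [cdf_le_one G (t + h), cdf_nonneg G t]
      _ = 1 / δ * δ := (one_div_mul_cancel hδ.ne').symm
      _ ≤ K * h := by gcongr; exact (le_max_right _ _).trans hK

variable [IsProbabilityMeasure G]

lemma continuous_cdf [NullSingletonClass G] : Continuous (cdf G) := by
  refine continuous_iff_continuousAt.2 fun x => ?_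
  rw [(monotone_cdf G).continuousAt_iff_leftLim_eq_rightLim, StieltjesFunction.rightLim_eq]
  have hjump := (cdf G).measure_singleton x
  rw [measure_cdf, measure_singleton] at hjump
  have := ENNReal.ofReal_eq_zero.1 hjump.symm
  linarith [(monotone_cdf G).leftLim_le (le_refl x)]

lemma measure_setOf_cdf_le (hcont : Continuous (cdf G)) {u : ℝ} (h1 : u < 1) :
    G {t | cdf G t ≤ u} = ENNReal.ofReal u := by
  obtain ⟨x, hx⟩ := ((tendsto_cdf_atTop G).eventually_const_lt h1).exists
  have hbdd : BddAbove {t | cdf G t ≤ u} :=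
    ⟨x, fun t ht => ((monotone_cdf G).reflect_lt (lt_of_le_of_lt ht hx)).le⟩
  rcases Set.eq_empty_or_nonempty {t | cdf G t ≤ u} with hempty | hne
  · have hlt : ∀ t, u ≤ cdf G t := fun t =>
      le_of_not_ge fun ht => Set.notMem_empty t (hempty ▸ ht)
    rw [hempty, measure_empty,
      ENNReal.ofReal_of_nonpos (ge_of_tendsto' (tendsto_cdf_atBot G) hlt)]
  · have hmax := (isClosed_le hcont continuous_const).csSup_mem hne hbdd
    set m := sSup {t | cdf G t ≤ u}
    have hm : cdf G m = u := by
      obtain ⟨y, hy⟩ := mem_range_of_exists_le_of_exists_ge hcont ⟨m, hmax⟩ ⟨x, hx.le⟩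
      exact le_antisymm hmax (hy ▸ monotone_cdf G (le_csSup hbdd hy.le))
    have hIic : {t | cdf G t ≤ u} = Set.Iic m := Set.Subset.antisymm
      (fun t ht => le_csSup hbdd ht) fun t ht => (monotone_cdf G ht).trans hmax
    rw [hIic, ← ofReal_cdf, hm]

lemma map_cdf_eq_volume (hcont : Continuous (cdf G)) :
    G.map (cdf G) = (volume : Measure ℝ).restrict (Set.Icc 0 1) := by
  have : IsProbabilityMeasure (G.map (cdf G)) :=
    Measure.isProbabilityMeasure_map hcont.measurable.aemeasurable
  refine Measure.ext_of_Iic _ _ fun u => ?_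
  rw [Measure.map_apply hcont.measurable measurableSet_Iic,
    Measure.restrict_apply measurableSet_Iic, Set.preimage]
  simp only [Set.mem_Iic]
  rcases le_or_gt 1 u with hu | hu
  · have hF : {t | cdf G t ≤ u} = Set.univ :=
      Set.eq_univ_of_forall fun t => (cdf_le_one G t).trans hu
    have hI : Set.Iic u ∩ Set.Icc (0 : ℝ) 1 = Set.Icc 0 1 :=
      Set.inter_eq_right.2 fun t ht => ht.2.trans hu
    rw [hF, hI, measure_univ, Real.volume_Icc, sub_zero, ENNReal.ofReal_one]
  · have hI : Set.Iic u ∩ Set.Icc (0 : ℝ) 1 = Set.Icc 0 u := by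
      rw [← Set.Ici_inter_Iic, Set.inter_left_comm, Set.Iic_inter_Iic, min_eq_left hu.le,
        Set.Ici_inter_Iic]
    rw [measure_setOf_cdf_le hcont hu, hI, Real.volume_Icc, sub_zero]

end Cdf

section Bump

/-- The reparametrization of `[0, 1]` which, read on the distribution function, increases the
weights. -/
def bump (τ u : ℝ) : ℝ := u + τ * u * (1 - u)

variable {τ u : ℝ}

@[fun_prop]
lemma continuous_bump : Continuous (bump τ) := by unfold bump; fun_prop

lemma hasDerivAt_bump : HasDerivAt (bump τ) (1 + τ * (1 - 2 * u)) u := by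
  have := (hasDerivAt_id u).add (((hasDerivAt_id u).const_mul τ).mul
    ((hasDerivAt_id u).const_sub 1))
  exact this.congr_deriv (by simp; ring)

lemma le_bump (h0 : 0 ≤ τ) (hu : u ∈ Set.Icc (0 : ℝ) 1) : u ≤ bump τ u :=
  le_add_of_nonneg_right (mul_nonneg (mul_nonneg h0 hu.1) (sub_nonneg.2 hu.2))

lemma bump_le_add (h0 : 0 ≤ τ) (hu : u ∈ Set.Icc (0 : ℝ) 1) : bump τ u ≤ u + τ := by
  have : u * (1 - u) ≤ 1 := mul_le_one₀ hu.2 (sub_nonneg.2 hu.2) (by linarith [hu.1])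
  unfold bump
  nlinarith

lemma bump_mem_Icc (h0 : 0 ≤ τ) (h1 : τ ≤ 1) (hu : u ∈ Set.Icc (0 : ℝ) 1) :
    bump τ u ∈ Set.Icc (0 : ℝ) 1 := by
  refine ⟨hu.1.trans (le_bump h0 hu), ?_⟩
  have : τ * u ≤ 1 := mul_le_one₀ h1 hu.1 hu.2
  unfold bump
  nlinarith [hu.2]

lemma strictMonoOn_bump (h0 : 0 ≤ τ) (h1 : τ < 1) : StrictMonoOn (bump τ) (Set.Icc 0 1) := by
  intro x hx y hy hxy
  have : 0 < (y - x) * (1 + τ * (1 - x - y)) :=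
    mul_pos (by linarith) (by nlinarith [hx.1, hx.2, hy.1, hy.2])
  unfold bump
  nlinarith

lemma image_bump (h0 : 0 ≤ τ) (h1 : τ ≤ 1) : bump τ '' Set.Icc 0 1 = Set.Icc 0 1 := by
  refine Set.Subset.antisymm (Set.image_subset_iff.2 fun u hu => bump_mem_Icc h0 h1 hu) ?_
  simpa [bump] using intermediate_value_Icc (zero_le_one' ℝ) (continuous_bump (τ := τ)).continuousOn

lemma lintegral_bump (h0 : 0 ≤ τ) (h1 : τ < 1) (g : ℝ → ℝ≥0∞) :
    ∫⁻ u in Set.Icc (0 : ℝ) 1, ENNReal.ofReal (1 + τ * (1 - 2 * u)) * g (bump τ u) =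
      ∫⁻ u in Set.Icc (0 : ℝ) 1, g u := by
  conv_rhs => rw [← image_bump h0 h1.le, lintegral_image_eq_lintegral_abs_deriv_mul
    measurableSet_Icc (fun u _ => hasDerivAt_bump.hasDerivWithinAt) (strictMonoOn_bump h0 h1).injOn]
  refine setLIntegral_congr_fun measurableSet_Icc fun u hu => ?_
  rw [abs_of_nonneg]
  nlinarith [hu.1, hu.2]

lemma lintegral_bump_deriv_pow_three (h0 : 0 ≤ τ) (h1 : τ ≤ 1) :
    ∫⁻ u in Set.Icc (0 : ℝ) 1, ENNReal.ofReal (1 + τ * (1 - 2 * u)) ^ 3 =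
      ENNReal.ofReal (1 + τ ^ 2) := by
  have hnonneg : ∀ u ∈ Set.Icc (0 : ℝ) 1, 0 ≤ 1 + τ * (1 - 2 * u) := fun u hu => by
    nlinarith [hu.1, hu.2]
  have hprim : ∀ u : ℝ, HasDerivAt
      (fun u : ℝ => (1 + τ) ^ 3 * u - 3 * (1 + τ) ^ 2 * τ * u ^ 2 + 4 * (1 + τ) * τ ^ 2 * u ^ 3
        - 2 * τ ^ 3 * u ^ 4) ((1 + τ * (1 - 2 * u)) ^ 3) u := fun u => by
    have := ((((hasDerivAt_id u).const_mul ((1 + τ) ^ 3)).sub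
      ((hasDerivAt_pow 2 u).const_mul (3 * (1 + τ) ^ 2 * τ))).add
      ((hasDerivAt_pow 3 u).const_mul (4 * (1 + τ) * τ ^ 2))).sub
      ((hasDerivAt_pow 4 u).const_mul (2 * τ ^ 3))
    exact this.congr_deriv (by simp; ring)
  have hint : ∫ u in (0 : ℝ)..1, (1 + τ * (1 - 2 * u)) ^ 3 = 1 + τ ^ 2 := by
    rw [intervalIntegral.integral_eq_sub_of_hasDerivAt (fun u _ => hprim u)
      (Continuous.intervalIntegrable (by fun_prop) _ _)]
    ring
  rw [setLIntegral_congr_fun measurableSet_Icc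
      fun u hu => (ENNReal.ofReal_pow (hnonneg u hu) 3).symm,
    ← ofReal_integral_eq_lintegral_ofReal (Continuous.integrableOn_Icc (by fun_prop))
      ((ae_restrict_iff' measurableSet_Icc).2 (.of_forall fun u hu => pow_nonneg (hnonneg u hu) 3)),
    integral_Icc_eq_integral_Ioc, ← intervalIntegral.integral_of_le zero_le_one, hint]

end Bump

section SiteShift

/-- `IsAdmissible` with its parameters named and the lower bound on the density integrated. -/
structure IsAdmissibleOn (G : Measure ℝ) (a b α : ℝ) : Prop where
  lt : a < b
  pos : 0 < α
  measure_compl : G (Set.Icc a b)ᶜ = 0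
  absolutelyContinuous : G ≪ volume
  mul_volume_le : ∀ s ⊆ Set.Icc a b, MeasurableSet s → ENNReal.ofReal α * volume s ≤ G s

lemma IsAdmissible.exists_isAdmissibleOn {G : Measure ℝ} (hG : IsAdmissible G) :
    ∃ a b α : ℝ, 0 < a ∧ IsAdmissibleOn G a b α := by
  obtain ⟨a, b, α, ha, hab, hα, hsupp, ρ, -, rfl, hρ⟩ := hG
  refine ⟨a, b, α, ha, hab, hα, hsupp, withDensity_absolutelyContinuous _ _, fun s hs hsm => ?_⟩
  rw [withDensity_apply _ hsm, ← setLIntegral_const]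
  exact lintegral_mono_ae <| (ae_restrict_iff' hsm).2 <| hρ.mono fun x hx hxs => hx (hs hxs)

/-- The inverse of the distribution function of a law supported on `[a, b]`; the argument is
truncated to `[0, 1]`, which makes it a monotone function on the whole line. -/
noncomputable def quantile (G : Measure ℝ) (a b u : ℝ) : ℝ :=
  Function.invFunOn (cdf G) (Set.Icc a b) (max 0 (min u 1))

/-- The increasing map of a single weight which conjugates to `bump τ` under the distribution
function of `G`. -/
noncomputable def siteShift (G : Measure ℝ) (a b τ t : ℝ) : ℝ :=
  quantile G a b (bump τ (cdf G t))

/-- The density with which `siteShift G a b τ` transports `G`. -/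
noncomputable def siteDensity (G : Measure ℝ) (τ t : ℝ) : ℝ≥0∞ :=
  ENNReal.ofReal (1 + τ * (1 - 2 * cdf G t))

lemma siteDensity_zero (G : Measure ℝ) : siteDensity G 0 = 1 := by
  ext; simp [siteDensity]

variable {G : Measure ℝ} {a b α τ t : ℝ}

namespace IsAdmissibleOn

variable (hG : IsAdmissibleOn G a b α)
include hG

lemma ae_mem_Icc : ∀ᵐ t ∂G, t ∈ Set.Icc a b := hG.measure_compl

lemma nullSingletonClass : NullSingletonClass G := ⟨fun _ => hG.absolutelyContinuous (by simp)⟩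

variable [IsProbabilityMeasure G]

lemma continuous_cdf : Continuous (cdf G) :=
  have := hG.nullSingletonClass
  FPP.continuous_cdf

lemma cdf_left : cdf G a = 0 := by
  have := hG.nullSingletonClass
  have : G (Set.Iio a) = 0 :=
    measure_mono_null (fun _ hx (h : _ ∈ Set.Icc a b) => not_lt.2 h.1 hx) hG.measure_compl
  rw [cdf_eq_real, Measure.real, ← measure_congr Iio_ae_eq_Iic, this, ENNReal.toReal_zero]

lemma cdf_right : cdf G b = 1 := by
  have : G (Set.Iic b) = 1 := (prob_compl_eq_zero_iff measurableSet_Iic).1 <|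
    measure_mono_null (fun _ hx (h : _ ∈ Set.Icc a b) => hx h.2) hG.measure_compl
  rw [cdf_eq_real, Measure.real, this, ENNReal.toReal_one]

lemma mul_sub_le_cdf_sub {x y : ℝ} (hx : a ≤ x) (hxy : x ≤ y) (hy : y ≤ b) :
    α * (y - x) ≤ cdf G y - cdf G x := by
  have h := hG.mul_volume_le (Set.Ioc x y)
    (Set.Ioc_subset_Icc_self.trans (Set.Icc_subset_Icc hx hy)) measurableSet_Ioc
  rw [Real.volume_Ioc, ← ENNReal.ofReal_mul hG.pos.le, ← measure_cdf G,
    (cdf G).measure_Ioc] at h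
  exact (ENNReal.ofReal_le_ofReal_iff (sub_nonneg.2 (monotone_cdf G hxy))).1 h

lemma strictMonoOn_cdf : StrictMonoOn (cdf G) (Set.Icc a b) := fun _ hx _ hy hxy =>
  sub_pos.1 <| (mul_pos hG.pos (sub_pos.2 hxy)).trans_le <|
    hG.mul_sub_le_cdf_sub hx.1 hxy.le hy.2

lemma ae_cdf_mem_Ioo : ∀ᵐ t ∂G, cdf G t ∈ Set.Ioo 0 1 := by
  have := hG.nullSingletonClass
  have ha : ∀ᵐ t ∂G, t ≠ a := by simp [ae_iff]
  have hb : ∀ᵐ t ∂G, t ≠ b := by simp [ae_iff]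
  filter_upwards [hG.ae_mem_Icc, ha, hb] with t ht hta htb
  rw [← hG.cdf_left, ← hG.cdf_right]
  exact ⟨hG.strictMonoOn_cdf ⟨le_rfl, hG.lt.le⟩ ht (lt_of_le_of_ne ht.1 hta.symm),
    hG.strictMonoOn_cdf ht ⟨hG.lt.le, le_rfl⟩ (lt_of_le_of_ne ht.2 htb)⟩

lemma exists_cdf_eq (u : ℝ) : ∃ t ∈ Set.Icc a b, cdf G t = max 0 (min u 1) :=
  intermediate_value_Icc hG.lt.le hG.continuous_cdf.continuousOn <| by
    rw [hG.cdf_left, hG.cdf_right]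
    exact ⟨le_max_left _ _, max_le zero_le_one (min_le_right _ _)⟩

lemma quantile_mem_Icc (u : ℝ) : quantile G a b u ∈ Set.Icc a b :=
  Function.invFunOn_mem (hG.exists_cdf_eq u)

lemma cdf_quantile (u : ℝ) : cdf G (quantile G a b u) = max 0 (min u 1) :=
  Function.invFunOn_eq (hG.exists_cdf_eq u)

lemma quantile_cdf (ht : t ∈ Set.Icc a b) : quantile G a b (cdf G t) = t := by
  refine hG.strictMonoOn_cdf.injOn (hG.quantile_mem_Icc _) ht ?_
  rw [hG.cdf_quantile, min_eq_left (cdf_le_one G t), max_eq_right (cdf_nonneg G t)]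

lemma monotone_quantile : Monotone (quantile G a b) := fun u v huv => by
  rw [← hG.strictMonoOn_cdf.le_iff_le (hG.quantile_mem_Icc u) (hG.quantile_mem_Icc v),
    hG.cdf_quantile, hG.cdf_quantile]
  gcongr

lemma cdf_siteShift (h0 : 0 ≤ τ) (h1 : τ ≤ 1) (t : ℝ) :
    cdf G (siteShift G a b τ t) = bump τ (cdf G t) := by
  have h := bump_mem_Icc h0 h1 (cdf_mem_Icc (G := G) t)
  rw [siteShift, hG.cdf_quantile, min_eq_left h.2, max_eq_right h.1]

lemma le_siteShift (h0 : 0 ≤ τ) (h1 : τ ≤ 1) (ht : t ∈ Set.Icc a b) :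
    t ≤ siteShift G a b τ t := by
  refine (hG.strictMonoOn_cdf.le_iff_le ht (hG.quantile_mem_Icc _)).1 ?_
  rw [← siteShift, hG.cdf_siteShift h0 h1]
  exact le_bump h0 (cdf_mem_Icc t)

lemma siteShift_le (h0 : 0 ≤ τ) (h1 : τ ≤ 1) (ht : t ∈ Set.Icc a b) :
    siteShift G a b τ t ≤ t + τ / α := by
  have h := hG.mul_sub_le_cdf_sub ht.1 (hG.le_siteShift h0 h1 ht) (hG.quantile_mem_Icc _).2
  rw [hG.cdf_siteShift h0 h1] at h
  rw [← sub_le_iff_le_add', le_div_iff₀' hG.pos]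
  linarith [bump_le_add h0 (cdf_mem_Icc (G := G) t)]

lemma lintegral_comp_cdf {g : ℝ → ℝ≥0∞} (hg : Measurable g) :
    ∫⁻ t, g (cdf G t) ∂G = ∫⁻ u in Set.Icc (0 : ℝ) 1, g u := by
  rw [← map_cdf_eq_volume hG.continuous_cdf, lintegral_map hg hG.continuous_cdf.measurable]

lemma isDensityTransport_siteShift (h0 : 0 ≤ τ) (h1 : τ < 1) :
    IsDensityTransport G (siteShift G a b τ) (siteDensity G τ) := by
  have hq := hG.monotone_quantile.measurable
  have hF := hG.continuous_cdf.measurable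
  have hφ : Measurable (siteShift G a b τ) :=
    hq.comp (continuous_bump.measurable.comp hF)
  have hw : Measurable (siteDensity G τ) := by unfold siteDensity; fun_prop
  refine ⟨hφ, hw, fun t => ?_, Measure.ext_of_lintegral _ fun g hg => ?_⟩
  · rw [siteDensity, ne_eq, ENNReal.ofReal_eq_zero, not_le]
    nlinarith [cdf_nonneg G t, cdf_le_one G t]
  calc ∫⁻ t, g t ∂((G.withDensity (siteDensity G τ)).map (siteShift G a b τ))
      = ∫⁻ t, siteDensity G τ t * g (siteShift G a b τ t) ∂G := by
        rw [lintegral_map hg hφ]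
        exact lintegral_withDensity_eq_lintegral_mul _ hw (hg.comp hφ)
    _ = ∫⁻ u in Set.Icc (0 : ℝ) 1,
          ENNReal.ofReal (1 + τ * (1 - 2 * u)) * g (quantile G a b (bump τ u)) :=
        hG.lintegral_comp_cdf (g := fun u =>
          ENNReal.ofReal (1 + τ * (1 - 2 * u)) * g (quantile G a b (bump τ u))) (by fun_prop)
    _ = ∫⁻ t, g (quantile G a b (cdf G t)) ∂G := by
        rw [lintegral_bump h0 h1 fun u => g (quantile G a b u),
          hG.lintegral_comp_cdf (g := fun u => g (quantile G a b u)) (by fun_prop)]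
    _ = ∫⁻ t, g t ∂G := lintegral_congr_ae <| hG.ae_mem_Icc.mono fun t ht => by
        simp only [hG.quantile_cdf ht]

lemma lintegral_siteDensity_pow_three (h0 : 0 ≤ τ) (h1 : τ ≤ 1) :
    ∫⁻ t, siteDensity G τ t ^ 3 ∂G = ENNReal.ofReal (1 + τ ^ 2) := by
  rw [← lintegral_bump_deriv_pow_three h0 h1]
  exact hG.lintegral_comp_cdf (g := fun u => ENNReal.ofReal (1 + τ * (1 - 2 * u)) ^ 3)
    (by fun_prop)

/-- The gain is `F (1 - F)` over the slope of the distribution function `F`, which is of order one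
except where `F` is steep or close to `0` or `1`. -/
lemma exists_add_mul_le_siteShift {ε : ℝ≥0∞} (hε : 0 < ε) :
    ∃ (κ : ℝ) (B : Set ℝ), 0 < κ ∧ MeasurableSet B ∧ G B ≤ ε ∧ ∀ t ∈ Set.Icc a b, t ∉ B →
      ∀ τ, 0 ≤ τ → τ ≤ 1 → t + κ * τ ≤ siteShift G a b τ t := by
  have hF := hG.continuous_cdf
  let S : ℕ → Set ℝ := fun K => {t | (∀ h, 0 ≤ h → cdf G (t + h) - cdf G t ≤ K * h) ∧
    1 ≤ K * (cdf G t * (1 - cdf G t))}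
  have hclosed : ∀ K, IsClosed (S K) := fun K => by
    have hlevel : IsClosed {t | 1 ≤ K * (cdf G t * (1 - cdf G t))} :=
      isClosed_le (by fun_prop) (by fun_prop)
    have hslope : IsClosed {t | ∀ h, 0 ≤ h → cdf G (t + h) - cdf G t ≤ K * h} := by
      simp only [Set.ofPred_forall]
      exact isClosed_iInter fun h => isClosed_iInter fun _ =>
        isClosed_le (by fun_prop) (by fun_prop)
    exact hslope.inter hlevel
  have hmono : Monotone S := fun K K' hK t ht => by
    have hKR : (K : ℝ) ≤ K' := Nat.cast_le.2 hK
    have := mul_nonneg (cdf_nonneg G t) (sub_nonneg.2 (cdf_le_one G t))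
    exact ⟨fun h hh => (ht.1 h hh).trans (by gcongr), ht.2.trans (by gcongr)⟩
  have hae : ∀ᵐ t ∂G, ∃ K, t ∈ S K := by
    filter_upwards [ae_exists_cdf_sub_le hG.absolutelyContinuous, hG.ae_cdf_mem_Ioo]
      with t ⟨K, hK⟩ ht
    have hpos : 0 < cdf G t * (1 - cdf G t) := mul_pos ht.1 (sub_pos.2 ht.2)
    obtain ⟨K', hK'⟩ := exists_nat_ge (1 / (cdf G t * (1 - cdf G t)))
    rw [div_le_iff₀ hpos] at hK'
    refine ⟨max K K', fun h hh => (hK h hh).trans ?_, hK'.trans ?_⟩ <;> gcongr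
    exacts [le_max_left _ _, le_max_right _ _]
  obtain ⟨K, hK⟩ := exists_measure_compl_le (fun K => (hclosed K).measurableSet) hmono hae hε
  refine ⟨1 / (K + 1) ^ 2, (S K)ᶜ, by positivity, (hclosed K).measurableSet.compl, hK,
    fun t ht htS τ h0 h1 => ?_⟩
  have hS := hmono K.le_succ (not_not.1 htS)
  have hslope := hS.1 _ (sub_nonneg.2 (hG.le_siteShift h0 h1 ht))
  rw [add_sub_cancel, hG.cdf_siteShift h0 h1, bump] at hslope
  have hgain := mul_le_mul_of_nonneg_left hS.2 h0
  push_cast at hslope hgain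
  rw [← le_sub_iff_add_le', one_div_mul_eq_div, div_le_iff₀ (by positivity)]
  nlinarith [hslope, hgain, K.cast_nonneg (α := ℝ)]

end IsAdmissibleOn

end SiteShift

section Lattice

variable {d : ℕ}

/-- The `ℓ¹` distance on `ℤ^d`, which is the graph distance of the lattice. -/
def l1dist (x y : Fin d → ℤ) : ℕ := ∑ i, (x i - y i).natAbs

lemma lattice_adj_iff {x y : Fin d → ℤ} : (lattice d).Adj x y ↔ l1dist x y = 1 := by
  change ∑ i, |x i - y i| = 1 ↔ _
  rw [l1dist, ← Nat.cast_inj (R := ℤ)]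
  push_cast
  rfl

lemma l1dist_self (x : Fin d → ℤ) : l1dist x x = 0 := by simp [l1dist]

lemma l1dist_comm (x y : Fin d → ℤ) : l1dist x y = l1dist y x :=
  Finset.sum_congr rfl fun i _ => by rw [← Int.natAbs_neg, neg_sub]

lemma l1dist_triangle (x y z : Fin d → ℤ) : l1dist x z ≤ l1dist x y + l1dist y z := by
  rw [l1dist, l1dist, l1dist, ← Finset.sum_add_distrib]
  exact Finset.sum_le_sum fun i _ => by omega

lemma eq_of_l1dist_eq_zero {x y : Fin d → ℤ} (h : l1dist x y = 0) : x = y := by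
  ext i
  have := (Finset.sum_eq_zero_iff.1 h) i (Finset.mem_univ i)
  omega

lemma l1dist_add_right (x y u : Fin d → ℤ) : l1dist (x + u) (y + u) = l1dist x y := by
  simp [l1dist]

/-- The `2d` unit steps of the lattice: `step (i, true)` is the `i`-th unit vector and
`step (i, false)` its opposite. -/
def step (s : Fin d × Bool) : Fin d → ℤ := Pi.single s.1 (if s.2 then 1 else -1)

lemma l1dist_add_step (x : Fin d → ℤ) (s : Fin d × Bool) : l1dist x (x + step s) = 1 := by
  rw [l1dist, Finset.sum_eq_single s.1]
  · rcases s with ⟨i, _ | _⟩ <;> simp [step]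
  · intro j _ hj
    simp [step, Pi.single_eq_of_ne hj]
  · simp

lemma exists_l1dist_eq_succ {x y : Fin d → ℤ} (h : x ≠ y) :
    ∃ s : Fin d × Bool, l1dist x y = l1dist (x + step s) y + 1 := by
  obtain ⟨i, hi⟩ := Function.ne_iff.1 h
  set s : Fin d × Bool := (i, decide (x i < y i)) with hs
  have toward : (x i - y i).natAbs = ((x + step s) i - y i).natAbs + 1 := by
    by_cases hlt : x i < y i <;> simp [hs, step, hlt] <;> omega
  have other : ∀ j ∈ Finset.univ.erase i, (x j - y j).natAbs = ((x + step s) j - y j).natAbs :=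
    fun j hj => by simp [hs, step, Pi.single_eq_of_ne (Finset.ne_of_mem_erase hj)]
  refine ⟨s, ?_⟩
  rw [l1dist, l1dist, ← Finset.add_sum_erase _ _ (Finset.mem_univ i), Finset.sum_congr rfl other,
    ← Finset.add_sum_erase _ (fun j => ((x + step s) j - y j).natAbs) (Finset.mem_univ i), toward]
  ring

lemma lattice_adj_iff_exists_step {x y : Fin d → ℤ} :
    (lattice d).Adj x y ↔ ∃ s, y = x + step s := by
  constructor
  · intro h
    obtain ⟨s, hs⟩ := exists_l1dist_eq_succ h.ne
    rw [lattice_adj_iff] at h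
    exact ⟨s, (eq_of_l1dist_eq_zero (by omega)).symm⟩
  · rintro ⟨s, rfl⟩
    exact lattice_adj_iff.2 (l1dist_add_step x s)

lemma exists_walk_length_eq_l1dist (x y : Fin d → ℤ) :
    ∃ p : (lattice d).Walk x y, p.length = l1dist x y := by
  induction hn : l1dist x y generalizing x with
  | zero =>
    obtain rfl := eq_of_l1dist_eq_zero hn
    exact ⟨.nil, rfl⟩
  | succ n ih =>
    have hxy : x ≠ y := by
      rintro rfl
      simp [l1dist_self] at hn
    obtain ⟨s, hs⟩ := exists_l1dist_eq_succ hxy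
    obtain ⟨p, hp⟩ := ih (x + step s) (by omega)
    exact ⟨.cons (lattice_adj_iff_exists_step.2 ⟨s, rfl⟩) p, by simp [hp]⟩

lemma l1dist_le_length {x y : Fin d → ℤ} (p : (lattice d).Walk x y) : l1dist x y ≤ p.length := by
  induction p with
  | nil => simp [l1dist_self]
  | @cons x y z h p ih =>
    have := l1dist_triangle x y z
    rw [lattice_adj_iff] at h
    simp only [SimpleGraph.Walk.length_cons]
    omega

lemma l1dist_getVert_le {x y : Fin d → ℤ} (p : (lattice d).Walk x y) (i j : ℕ) :
    l1dist (p.getVert i) (p.getVert (i + j)) ≤ j := by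
  have h := l1dist_le_length ((p.drop i).take j)
  rw [SimpleGraph.Walk.take_length] at h
  rw [← SimpleGraph.Walk.drop_getVert]
  exact h.trans (min_le_left _ _)

noncomputable instance : (lattice d).LocallyFinite := fun x =>
  (Set.Finite.subset (Set.finite_range fun s => x + step s) fun y hy => by
    obtain ⟨s, hs⟩ := lattice_adj_iff_exists_step.1 hy
    exact ⟨s, hs.symm⟩).fintype

instance {x y : Fin d → ℤ} : Countable ((lattice d).Walk x y) :=
  Function.Injective.countable (f := SimpleGraph.Walk.support)
    fun _ _ h => SimpleGraph.Walk.ext_support h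

end Lattice

section Walks

variable {d : ℕ} {x y z : Fin d → ℤ}

/-- The edges of a walk in order, as elements of `Edge d` rather than of `Sym2 (Fin d → ℤ)`. -/
def walkEdges (p : (lattice d).Walk x y) : List (Edge d) :=
  p.darts.map fun a => ⟨a.edge, a.edge_mem⟩

lemma map_val_walkEdges (p : (lattice d).Walk x y) :
    (walkEdges p).map Subtype.val = p.edges := by
  simp [walkEdges, SimpleGraph.Walk.edges, Function.comp_def]

lemma mem_walkEdges {p : (lattice d).Walk x y} {e : Edge d} :
    e ∈ walkEdges p ↔ (e : Sym2 (Fin d → ℤ)) ∈ p.edges := by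
  rw [← map_val_walkEdges, List.mem_map_of_injective Subtype.val_injective]

@[simp] lemma length_walkEdges (p : (lattice d).Walk x y) :
    (walkEdges p).length = p.length := by simp [walkEdges]

lemma walkEdges_append (p : (lattice d).Walk x y) (p' : (lattice d).Walk y z) :
    walkEdges (p.append p') = walkEdges p ++ walkEdges p' := by
  simp [walkEdges, SimpleGraph.Walk.darts_append]

lemma walkEdges_take (p : (lattice d).Walk x y) (n : ℕ) :
    walkEdges (p.take n) = (walkEdges p).take n := by
  simp [walkEdges, SimpleGraph.Walk.darts_take, List.map_take]

lemma walkEdges_drop (p : (lattice d).Walk x y) (n : ℕ) :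
    walkEdges (p.drop n) = (walkEdges p).drop n := by
  simp [walkEdges, SimpleGraph.Walk.darts_drop, List.map_drop]

lemma val_getElem_walkEdges (p : (lattice d).Walk x y) {i : ℕ} (hi : i < (walkEdges p).length) :
    ((walkEdges p)[i] : Sym2 (Fin d → ℤ)) = s(p.getVert i, p.getVert (i + 1)) := by
  have hi' : i < p.darts.length := by simpa using hi
  have h : ((walkEdges p)[i] : Sym2 (Fin d → ℤ)) = s(p.darts[i].fst, p.darts[i].snd) := by
    simp only [walkEdges, List.getElem_map]
    rfl
  rw [h, SimpleGraph.Walk.fst_darts_getElem, SimpleGraph.Walk.snd_darts_getElem,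
    List.getElem_dropLast, List.getElem_tail, SimpleGraph.Walk.support_getElem_eq_getVert,
    SimpleGraph.Walk.support_getElem_eq_getVert]

lemma passageTime_eq (t : Edge d → ℝ) (p : (lattice d).Walk x y) :
    passageTime t p = ((walkEdges p).map t).sum := by
  simp [passageTime, walkEdges, Function.comp_def]

lemma passageTime_append (t : Edge d → ℝ) (p : (lattice d).Walk x y) (p' : (lattice d).Walk y z) :
    passageTime t (p.append p') = passageTime t p + passageTime t p' := by
  simp [passageTime_eq, walkEdges_append]

lemma passageTime_const (c : ℝ) (p : (lattice d).Walk x y) :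
    passageTime (fun _ => c) p = c * p.length := by
  simp [passageTime_eq, mul_comm]

lemma passageTime_add_const_mul (t s : Edge d → ℝ) (c : ℝ) (p : (lattice d).Walk x y) :
    passageTime (fun e => t e + c * s e) p = passageTime t p + c * passageTime s p := by
  simp only [passageTime_eq, List.sum_map_add, List.sum_map_mul_left]

lemma passageTime_mono {t s : Edge d → ℝ} {p : (lattice d).Walk x y}
    (h : ∀ e ∈ walkEdges p, t e ≤ s e) : passageTime t p ≤ passageTime s p := by
  rw [passageTime_eq, passageTime_eq]
  exact List.sum_le_sum h

lemma mul_length_le_passageTime {a : ℝ} {t : Edge d → ℝ} (ht : ∀ e, a ≤ t e)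
    (p : (lattice d).Walk x y) : a * p.length ≤ passageTime t p :=
  (passageTime_const a p).symm.trans_le (passageTime_mono fun e _ => ht e)

lemma passageTime_le_mul_length {b : ℝ} {t : Edge d → ℝ} (ht : ∀ e, t e ≤ b)
    (p : (lattice d).Walk x y) : passageTime t p ≤ b * p.length :=
  (passageTime_mono fun e _ => ht e).trans_eq (passageTime_const b p)

end Walks

section Geodesics

variable {d : ℕ} {a b : ℝ} {t : Edge d → ℝ} {x y : Fin d → ℤ}

lemma exists_isGeodesic (ha : 0 < a) (hta : ∀ e, a ≤ t e) (x y : Fin d → ℤ) :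
    ∃ p : (lattice d).Walk x y, IsGeodesic t p := by
  classical
  obtain ⟨p₀, -⟩ := exists_walk_length_eq_l1dist x y
  obtain ⟨N, hN⟩ := exists_nat_gt (passageTime t p₀ / a)
  rw [div_lt_iff₀' ha] at hN
  have long : ∀ p : (lattice d).Walk x y, N ≤ p.length → passageTime t p₀ < passageTime t p :=
    fun p hp => hN.trans_le <|
      (mul_le_mul_of_nonneg_left (Nat.cast_le.2 hp) ha.le).trans (mul_length_le_passageTime hta p)
  have hp₀ : p₀ ∈ (lattice d).finsetWalkLengthLT N x y := by
    rw [SimpleGraph.mem_finsetWalkLengthLT_iff]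
    exact lt_of_not_ge fun h => (long p₀ h).false
  obtain ⟨p, -, hmin⟩ := Finset.exists_min_image _ (passageTime t) ⟨p₀, hp₀⟩
  refine ⟨p, fun p' => ?_⟩
  by_cases h : p' ∈ (lattice d).finsetWalkLengthLT N x y
  · exact hmin p' h
  · rw [SimpleGraph.mem_finsetWalkLengthLT_iff, not_lt] at h
    exact (hmin p₀ hp₀).trans (long p' h).le

lemma IsGeodesic.mul_le_mul_l1dist_getVert (hta : ∀ e, a ≤ t e) (htb : ∀ e, t e ≤ b)
    {p : (lattice d).Walk x y} (hp : IsGeodesic t p) {i j : ℕ} (hij : i + j ≤ p.length) :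
    a * j ≤ b * l1dist (p.getVert i) (p.getVert (i + j)) := by
  obtain ⟨r, hr⟩ := exists_walk_length_eq_l1dist (p.getVert i) ((p.drop i).getVert j)
  have shortcut := hp (((p.take i).append r).append ((p.drop i).drop j))
  have split : passageTime t p = passageTime t (p.take i) +
      (passageTime t ((p.drop i).take j) + passageTime t ((p.drop i).drop j)) := by
    rw [← passageTime_append, SimpleGraph.Walk.append_take_drop_eq, ← passageTime_append,
      SimpleGraph.Walk.append_take_drop_eq]
  have lower := mul_length_le_passageTime hta ((p.drop i).take j)
  have upper := passageTime_le_mul_length htb r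
  have hj : ((p.drop i).take j).length = j := by
    rw [SimpleGraph.Walk.take_length, SimpleGraph.Walk.drop_length]
    omega
  rw [passageTime_append, passageTime_append] at shortcut
  rw [hj] at lower
  rw [hr] at upper
  rw [← SimpleGraph.Walk.drop_getVert]
  linarith

lemma IsGeodesic.mul_length_le_mul_l1dist (hta : ∀ e, a ≤ t e) (htb : ∀ e, t e ≤ b)
    {p : (lattice d).Walk x y} (hp : IsGeodesic t p) : a * p.length ≤ b * l1dist x y := by
  simpa using hp.mul_le_mul_l1dist_getVert hta htb (i := 0) (j := p.length) (by simp)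

lemma IsGeodesic.isPath (ha : 0 < a) (hta : ∀ e, a ≤ t e) (htb : ∀ e, t e ≤ b)
    {p : (lattice d).Walk x y} (hp : IsGeodesic t p) : p.IsPath := by
  have no_loop : ∀ i j, i + j ≤ p.length → p.getVert i = p.getVert (i + j) → j = 0 := by
    intro i j hij h
    have := hp.mul_le_mul_l1dist_getVert hta htb hij
    rw [h, l1dist_self, Nat.cast_zero, mul_zero] at this
    exact_mod_cast le_antisymm (nonpos_of_mul_nonpos_right this ha) (Nat.cast_nonneg j)
  rw [← SimpleGraph.Walk.IsPath.getVert_injOn_iff]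
  intro i (hi : i ≤ p.length) j (hj : j ≤ p.length) h
  rcases le_total i j with hij | hij
  · obtain ⟨k, rfl⟩ := Nat.exists_eq_add_of_le hij
    simp [no_loop i k hj h]
  · obtain ⟨k, rfl⟩ := Nat.exists_eq_add_of_le hij
    simp [no_loop j k hi h.symm]

lemma IsGeodesic.nodup_walkEdges (ha : 0 < a) (hta : ∀ e, a ≤ t e) (htb : ∀ e, t e ≤ b)
    {p : (lattice d).Walk x y} (hp : IsGeodesic t p) : (walkEdges p).Nodup :=
  List.Nodup.of_map Subtype.val
    ((map_val_walkEdges p).symm ▸ (hp.isPath ha hta htb).isTrail.edges_nodup)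

/-- Connecting the ends of `p` to those of `p'` by shortest paths turns each geodesic into a
competitor of the other one. -/
lemma IsGeodesic.passageTime_sub_le {t' : Edge d → ℝ} (htb : ∀ e, t e ≤ b)
    (htb' : ∀ e, t' e ≤ b) {x' y' : Fin d → ℤ} {p : (lattice d).Walk x y}
    (hp : IsGeodesic t' p) {p' : (lattice d).Walk x' y'} (hp' : IsGeodesic t p') :
    passageTime t' p - passageTime t p ≤
      passageTime t' p' - passageTime t p' + 2 * b * (l1dist x x' + l1dist y y') := by
  obtain ⟨r, hr⟩ := exists_walk_length_eq_l1dist x x'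
  obtain ⟨s, hs⟩ := exists_walk_length_eq_l1dist y y'
  have h1 := hp ((r.append p').append s.reverse)
  have h2 := hp' ((r.reverse.append p).append s)
  have h3 := passageTime_le_mul_length htb' r
  have h4 := passageTime_le_mul_length htb' s.reverse
  have h5 := passageTime_le_mul_length htb r.reverse
  have h6 := passageTime_le_mul_length htb s
  rw [SimpleGraph.Walk.length_reverse] at h4 h5
  rw [hr] at h3 h5
  rw [hs] at h4 h6
  simp only [passageTime_append] at h1 h2
  linarith

end Geodesics

section Translation

variable {d : ℕ} {x y : Fin d → ℤ}

/-- Translation by `u` as an automorphism of the lattice. -/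
def translate (u : Fin d → ℤ) : lattice d ≃g lattice d where
  toEquiv := Equiv.addRight u
  map_rel_iff' := by
    intro x y
    rw [lattice_adj_iff, lattice_adj_iff]
    exact Eq.congr_left (l1dist_add_right x y u)

/-- Translation of edges by `u`. -/
def translateEdge (u : Fin d → ℤ) : Edge d ≃ Edge d := (translate u).mapEdgeSet

lemma val_translateEdge_symm (u : Fin d → ℤ) (e : Edge d) :
    ((translateEdge u).symm e : Sym2 (Fin d → ℤ)) = (e : Sym2 (Fin d → ℤ)).map (· + -u) := by
  obtain ⟨e, rfl⟩ := (translateEdge u).surjective e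
  have h : (translateEdge u e : Sym2 (Fin d → ℤ)) = (e : Sym2 (Fin d → ℤ)).map (· + u) := rfl
  rw [Equiv.symm_apply_apply, h, Sym2.map_map]
  simp

lemma translateEdge_symm_injective_left (e : Edge d) :
    Function.Injective fun u : Fin d → ℤ => (translateEdge u).symm e := by
  intro u u' h
  have hmap : (e : Sym2 (Fin d → ℤ)).map (· + -u) = (e : Sym2 (Fin d → ℤ)).map (· + -u') := by
    rw [← val_translateEdge_symm, ← val_translateEdge_symm]
    exact congrArg Subtype.val h
  obtain ⟨e, he⟩ := e
  induction e using Sym2.ind with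
  | _ x y =>
    simp only [Sym2.map_mk, Sym2.eq_iff] at hmap
    rcases hmap with ⟨hx, -⟩ | ⟨hxy, hyx⟩
    · simpa using hx
    · ext i
      have hxy := congrFun hxy i
      have hyx := congrFun hyx i
      simp only [Pi.add_apply, Pi.neg_apply] at hxy hyx
      omega

/-- The translate of a walk by `u`. -/
def translateWalk (u : Fin d → ℤ) (p : (lattice d).Walk x y) : (lattice d).Walk (x + u) (y + u) :=
  p.map (translate u).toHom

lemma translateWalk_surjective (u : Fin d → ℤ) :
    Function.Surjective (translateWalk u : (lattice d).Walk x y → _) := by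
  intro p
  have hx : (translate u).symm.toHom (x + u) = x := (translate u).symm_apply_apply x
  have hy : (translate u).symm.toHom (y + u) = y := (translate u).symm_apply_apply y
  refine ⟨(p.map (translate u).symm.toHom).copy hx hy, SimpleGraph.Walk.ext_support ?_⟩
  refine (SimpleGraph.Walk.support_map _ _).trans ?_
  refine (congrArg _ ((SimpleGraph.Walk.support_copy _ hx hy).trans
    (SimpleGraph.Walk.support_map _ _))).trans ?_
  rw [List.map_map]
  refine (List.map_congr_left (g := id) fun z _ => ?_).trans (List.map_id _)
  exact (translate u).apply_symm_apply z

lemma walkEdges_translateWalk (u : Fin d → ℤ) (p : (lattice d).Walk x y) :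
    walkEdges (translateWalk u p) = (walkEdges p).map (translateEdge u) := by
  have : (translateWalk u p).darts = p.darts.map (translate u).toHom.mapDart :=
    SimpleGraph.Walk.darts_map _ _
  simp only [walkEdges, this, List.map_map]
  rfl

lemma isGeodesic_translateWalk {t : Edge d → ℝ} {u : Fin d → ℤ} {p : (lattice d).Walk x y} :
    IsGeodesic t (translateWalk u p) ↔ IsGeodesic (fun e => t (translateEdge u e)) p := by
  have h (p : (lattice d).Walk x y) :
      passageTime t (translateWalk u p) = passageTime (fun e => t (translateEdge u e)) p := by
    rw [passageTime_eq, passageTime_eq, walkEdges_translateWalk, List.map_map]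
    rfl
  simp only [IsGeodesic, (translateWalk_surjective u).forall, h]

lemma translateEdge_mem_geodesicEdges {t : Edge d → ℝ} {u : Fin d → ℤ} {e : Edge d} :
    translateEdge u e ∈ geodesicEdges t (x + u) (y + u) ↔
      e ∈ geodesicEdges (fun e => t (translateEdge u e)) x y := by
  have h (p : (lattice d).Walk x y) : translateEdge u e ∈ walkEdges (translateWalk u p) ↔
      e ∈ walkEdges p := by
    rw [walkEdges_translateWalk, List.mem_map_of_injective (translateEdge u).injective]
  simp only [geodesicEdges, Set.mem_ofPred_eq, (translateWalk_surjective u).exists,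
    isGeodesic_translateWalk, ← mem_walkEdges, h]

end Translation

section Environment

variable {d : ℕ} {x y : Fin d → ℤ}

lemma measurable_passageTime (p : (lattice d).Walk x y) :
    Measurable fun t : Edge d → ℝ => passageTime t p := by
  simp only [passageTime_eq]
  induction walkEdges p with
  | nil => simp
  | cons e l ih =>
    simp only [List.map_cons, List.sum_cons]
    exact (measurable_pi_apply e).add ih

lemma measurableSet_mem_geodesicEdges (x y : Fin d → ℤ) (e : Edge d) :
    MeasurableSet {t : Edge d → ℝ | e ∈ geodesicEdges t x y} := by
  have hgeodesic (p : (lattice d).Walk x y) : MeasurableSet {t : Edge d → ℝ | IsGeodesic t p} := by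
    simp only [IsGeodesic, Set.ofPred_forall]
    exact MeasurableSet.iInter fun p' =>
      measurableSet_le (measurable_passageTime p) (measurable_passageTime p')
  have : {t : Edge d → ℝ | e ∈ geodesicEdges t x y} =
      ⋃ p : (lattice d).Walk x y, {t : Edge d → ℝ | IsGeodesic t p} ∩
        {_t : Edge d → ℝ | (e : Sym2 (Fin d → ℤ)) ∈ p.edges} := by
    ext t
    simp only [geodesicEdges, Set.mem_iUnion]
    rfl
  rw [this]
  exact MeasurableSet.iUnion fun p => (hgeodesic p).inter (MeasurableSet.const _)

/-- The law of an i.i.d. environment with weight distribution `G`. -/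
noncomputable abbrev environment (d : ℕ) (G : Measure ℝ) : Measure (Edge d → ℝ) :=
  Measure.infinitePi fun _ => G

lemma IsIIDEnvironment.geodesicProb_eq {G : Measure ℝ} {Ω : Type*} [MeasurableSpace Ω]
    {P : Measure Ω} {t : Edge d → Ω → ℝ} (h : IsIIDEnvironment P t G) (v : Fin d → ℤ) (e : Edge d) :
    geodesicProb P t v e = environment d G {t | e ∈ geodesicEdges t 0 v} := by
  have hl := h.indep.hasLaw_infinitePi h.hasLaw
    (aemeasurable_pi_iff.2 fun e => (h.hasLaw e).aemeasurable)
  rw [environment, ← hl.map_eq, Measure.map_apply_of_aemeasurable hl.aemeasurable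
    (measurableSet_mem_geodesicEdges 0 v e)]
  rfl

variable {G : Measure ℝ} [IsProbabilityMeasure G]

lemma environment_mem_geodesicEdges_add (u x y : Fin d → ℤ) (e : Edge d) :
    environment d G {t | e ∈ geodesicEdges t (x + u) (y + u)} =
      environment d G {t | (translateEdge u).symm e ∈ geodesicEdges t x y} := by
  have h := Measure.map_infinitePi_infinitePi_of_inj (P := fun _ : Edge d => G)
    (translateEdge u).injective
  conv_rhs => rw [environment, ← h]
  rw [Measure.map_apply (by fun_prop) (measurableSet_mem_geodesicEdges x y _)]
  congr 1
  ext t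
  obtain ⟨e, rfl⟩ := (translateEdge u).surjective e
  rw [Equiv.symm_apply_apply]
  exact translateEdge_mem_geodesicEdges

lemma passageTime_update [DecidableEq (Edge d)] (t : Edge d → ℝ) (e : Edge d) (s : ℝ)
    (p : (lattice d).Walk x y) :
    passageTime (Function.update t e s) p =
      passageTime (Function.update t e 0) p + s * (walkEdges p).count e := by
  have hupdate : Function.update t e s =
      fun e' => Function.update t e 0 e' + s * (if e' = e then 1 else 0) := by
    ext e'
    by_cases h : e' = e
    · subst h; simp
    · simp [h]
  have hcount : passageTime (fun e' => if e' = e then 1 else 0) p = (walkEdges p).count e := by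
    rw [passageTime_eq]
    induction walkEdges p with
    | nil => simp
    | cons e' l ih =>
      simp only [List.map_cons, List.sum_cons, ih, List.count_cons, beq_iff_eq]
      push_cast
      ring
  rw [hupdate, passageTime_add_const_mul, hcount]

lemma ae_passageTime_ne [NullSingletonClass G] {p p' : (lattice d).Walk x y} {e : Edge d}
    (he : e ∈ walkEdges p) (he' : e ∉ walkEdges p') :
    ∀ᵐ t ∂environment d G, passageTime t p ≠ passageTime t p' := by
  classical
  refine ae_infinitePi_of_forall_ae_update e
    (measurableSet_eq_fun (measurable_passageTime p) (measurable_passageTime p')).compl fun t => ?_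
  have hc : (0 : ℝ) < (walkEdges p).count e := by exact_mod_cast List.count_pos_iff.2 he
  have hne : ∀ᵐ s ∂G, s ≠ (passageTime (Function.update t e 0) p' -
      passageTime (Function.update t e 0) p) / (walkEdges p).count e := by
    rw [ae_iff]
    simp
  filter_upwards [hne] with s hs heq
  rw [passageTime_update, passageTime_update t e s p', List.count_eq_zero_of_not_mem he'] at heq
  refine hs ((eq_div_iff hc.ne').2 ?_)
  push_cast at heq
  linarith

lemma ae_geodesicEdges_eq [NullSingletonClass G] (x y : Fin d → ℤ) :
    ∀ᵐ t ∂environment d G, ∀ p : (lattice d).Walk x y, IsGeodesic t p →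
      geodesicEdges t x y = {e | e ∈ walkEdges p} := by
  have h : ∀ᵐ t ∂environment d G, ∀ p p' : (lattice d).Walk x y, ∀ e : Edge d,
      e ∈ walkEdges p → e ∉ walkEdges p' → passageTime t p ≠ passageTime t p' := by
    simp only [ae_all_iff, Filter.eventually_imp_distrib_left]
    exact fun p p' e he he' => ae_passageTime_ne he he'
  filter_upwards [h] with t ht p hp
  ext e
  refine ⟨?_, fun he => ⟨p, hp, mem_walkEdges.1 he⟩⟩
  rintro ⟨p', hp', he⟩
  by_contra hn
  exact ht p' p e (mem_walkEdges.2 he) hn (le_antisymm (hp' p) (hp p'))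

end Environment

section Cube

variable {d : ℕ}

/-- The lattice points of sup norm at most `R`. -/
noncomputable def cube (d R : ℕ) : Finset (Fin d → ℤ) :=
  Finset.Icc (fun _ => -(R : ℤ)) (fun _ => (R : ℤ))

lemma card_cube (R : ℕ) : (cube d R).card = (2 * R + 1) ^ d := by
  rw [cube, Pi.card_Icc]
  simp only [Int.card_Icc, Finset.prod_const, Finset.card_univ, Fintype.card_fin]
  congr 1
  omega

lemma l1dist_add_le_of_mem_cube {R : ℕ} {u : Fin d → ℤ} (hu : u ∈ cube d R) (x : Fin d → ℤ) :
    l1dist x (x + u) ≤ d * R := by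
  rw [cube, Finset.mem_Icc] at hu
  have : ∀ i ∈ (Finset.univ : Finset (Fin d)), (x i - (x + u) i).natAbs ≤ R := by
    intro i _
    have h1 : -(R : ℤ) ≤ u i := hu.1 i
    have h2 : u i ≤ R := hu.2 i
    simp only [Pi.add_apply]
    omega
  simpa [l1dist] using Finset.sum_le_card_nsmul _ _ _ this

lemma mem_cube_of_l1dist_le {R : ℕ} {x : Fin d → ℤ} (h : l1dist 0 x ≤ R) : x ∈ cube d R := by
  have key (i : Fin d) : (x i).natAbs ≤ R := by
    have := Finset.single_le_sum (f := fun i => ((0 : Fin d → ℤ) i - x i).natAbs)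
      (fun _ _ => Nat.zero_le _) (Finset.mem_univ i)
    simp only [Pi.zero_apply, zero_sub, Int.natAbs_neg] at this
    exact this.trans (by simpa [l1dist] using h)
  rw [cube, Finset.mem_Icc]
  refine ⟨fun i => ?_, fun i => ?_⟩ <;> have := key i <;> simp only <;> omega

end Cube

section Translates

variable {d : ℕ} {x y : Fin d → ℤ} {p : (lattice d).Walk x y}

lemma card_le_of_forall_le_add {s : Finset ℕ} {D : ℕ} (h : ∀ i ∈ s, ∀ j ∈ s, j ≤ i + D) :
    s.card ≤ D + 1 := by
  rcases s.eq_empty_or_nonempty with rfl | hs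
  · simp
  · have : s ⊆ Finset.Icc (s.min' hs) (s.min' hs + D) := fun j hj =>
      Finset.mem_Icc.2 ⟨s.min'_le j hj, h _ (s.min'_mem hs) j hj⟩
    exact (Finset.card_le_card this).trans (by rw [Nat.card_Icc]; omega)

lemma l1dist_getVert_le_of_getElem_eq {u c : Fin d → ℤ} {e : Edge d} {R i : ℕ}
    (hu : u ∈ cube d R) (hc : c ∈ (e : Sym2 (Fin d → ℤ))) (hi : i < (walkEdges p).length)
    (he : (walkEdges p)[i] = (translateEdge u).symm e) :
    l1dist (p.getVert i) c ≤ d * R + 1 := by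
  have hmem : c + -u ∈ s(p.getVert i, p.getVert (i + 1)) := by
    rw [← val_getElem_walkEdges p hi, he, val_translateEdge_symm]
    exact Sym2.mem_map.2 ⟨c, hc, rfl⟩
  have hnear : l1dist (p.getVert i) (c + -u) ≤ 1 := by
    rcases Sym2.mem_iff.1 hmem with h | h
    · simp [h, l1dist_self]
    · exact h ▸ l1dist_getVert_le p i 1
  have hshift : l1dist (c + -u) c ≤ d * R := by
    simpa using l1dist_add_le_of_mem_cube hu (c + -u)
  have := l1dist_triangle (p.getVert i) (c + -u) c
  omega

lemma IsGeodesic.le_add_floor {a b : ℝ} {t : Edge d → ℝ} (ha : 0 < a) (hta : ∀ e, a ≤ t e)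
    (htb : ∀ e, t e ≤ b) (hp : IsGeodesic t p) {c : Fin d → ℤ} {D i j : ℕ}
    (hj : j < (walkEdges p).length) (hic : l1dist (p.getVert i) c ≤ D)
    (hjc : l1dist (p.getVert j) c ≤ D) : j ≤ i + ⌊b / a * (2 * D)⌋₊ := by
  rcases le_total j i with hji | hij
  · omega
  obtain ⟨k, rfl⟩ := Nat.exists_eq_add_of_le hij
  have hb : 0 ≤ b := (ha.le.trans (hta (walkEdges p)[i + k])).trans (htb _)
  have hdist : l1dist (p.getVert i) (p.getVert (i + k)) ≤ 2 * D := by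
    have := l1dist_triangle (p.getVert i) c (p.getVert (i + k))
    rw [l1dist_comm] at hjc
    omega
  have hk : (k : ℝ) ≤ b / a * (2 * D) := by
    rw [div_mul_eq_mul_div, le_div_iff₀' ha]
    rw [length_walkEdges] at hj
    refine (hp.mul_le_mul_l1dist_getVert hta htb hj.le).trans (mul_le_mul_of_nonneg_left ?_ hb)
    exact_mod_cast hdist
  have := Nat.le_floor hk
  omega

open Classical in
lemma IsGeodesic.card_translates_le {a b : ℝ} {t : Edge d → ℝ} (ha : 0 < a)
    (hta : ∀ e, a ≤ t e) (htb : ∀ e, t e ≤ b) (hp : IsGeodesic t p) (e : Edge d) (R : ℕ) :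
    ((cube d R).filter fun u => (translateEdge u).symm e ∈ walkEdges p).card ≤
      ⌊b / a * (2 * (d * R + 1 : ℕ))⌋₊ + 1 := by
  set S := (cube d R).filter fun u => (translateEdge u).symm e ∈ walkEdges p
  have hindex : ∀ u ∈ S, ∃ i, ∃ hi : i < (walkEdges p).length,
      (walkEdges p)[i] = (translateEdge u).symm e := fun u hu =>
    List.mem_iff_getElem.1 (Finset.mem_filter.1 hu).2
  choose! f hf hfe using hindex
  have hinj : Set.InjOn f S := by
    intro u hu u' hu' h
    refine translateEdge_symm_injective_left e ?_
    simp only [← hfe u hu, ← hfe u' hu', h]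
  have hnear : ∀ u ∈ S, l1dist (p.getVert (f u)) (e : Sym2 (Fin d → ℤ)).out.1 ≤ d * R + 1 :=
    fun u hu => l1dist_getVert_le_of_getElem_eq (Finset.mem_filter.1 hu).1
      (Sym2.out_fst_mem _) (hf u hu) (hfe u hu)
  rw [← Finset.card_image_of_injOn hinj]
  refine card_le_of_forall_le_add fun i hi j hj => ?_
  obtain ⟨u, hu, rfl⟩ := Finset.mem_image.1 hi
  obtain ⟨u', hu', rfl⟩ := Finset.mem_image.1 hj
  exact hp.le_add_floor ha hta htb (hf u' hu') (hnear u hu) (hnear u' hu')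

end Translates

section GeodesicWeight

variable {d : ℕ} {x y : Fin d → ℤ} {t : Edge d → ℝ} {p : (lattice d).Walk x y}

/-- The total `q`-weight of the edges of the geodesic from `x` to `y` in the environment `t`, or
of all geodesics together on the null set where there are several. -/
noncomputable def geodesicWeight (q : Edge d → ℝ≥0) (x y : Fin d → ℤ) (t : Edge d → ℝ) : ℝ≥0∞ :=
  ∑' e : geodesicEdges t x y, (q e : ℝ≥0∞)

lemma geodesicWeight_eq_tsum_indicator (q : Edge d → ℝ≥0) (x y : Fin d → ℤ) :
    geodesicWeight q x y = fun t =>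
      ∑' e, {t : Edge d → ℝ | e ∈ geodesicEdges t x y}.indicator (fun _ => (q e : ℝ≥0∞)) t :=
  funext fun t => tsum_subtype (geodesicEdges t x y) fun e => (q e : ℝ≥0∞)

lemma measurable_geodesicWeight (q : Edge d → ℝ≥0) (x y : Fin d → ℤ) :
    Measurable (geodesicWeight q x y) := by
  rw [geodesicWeight_eq_tsum_indicator]
  exact Measurable.tsum fun e => measurable_const.indicator (measurableSet_mem_geodesicEdges x y e)

lemma lintegral_geodesicWeight (G : Measure ℝ) (q : Edge d → ℝ≥0) (x y : Fin d → ℤ) :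
    ∫⁻ t, geodesicWeight q x y t ∂environment d G =
      ∑' e, (q e : ℝ≥0∞) * environment d G {t | e ∈ geodesicEdges t x y} := by
  rw [geodesicWeight_eq_tsum_indicator, lintegral_tsum fun e =>
    (measurable_const.indicator (measurableSet_mem_geodesicEdges x y e)).aemeasurable]
  exact tsum_congr fun e => lintegral_indicator_const (measurableSet_mem_geodesicEdges x y e) _

lemma tsum_mem_walkEdges (q : Edge d → ℝ≥0) (hnd : (walkEdges p).Nodup) :
    ∑' e : {e | e ∈ walkEdges p}, (q e : ℝ≥0∞) =
      ENNReal.ofReal (passageTime (fun e => (q e : ℝ)) p) := by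
  classical
  have h : {e | e ∈ walkEdges p} = ((walkEdges p).toFinset : Set (Edge d)) := by ext; simp
  rw [h, Finset.tsum_subtype' (walkEdges p).toFinset fun e => (q e : ℝ≥0∞), passageTime_eq,
    ← List.sum_toFinset _ hnd, ENNReal.ofReal_sum_of_nonneg fun e _ => (q e).coe_nonneg]
  simp only [ENNReal.ofReal_coe_nnreal]

variable {G : Measure ℝ} [IsProbabilityMeasure G] {a b α : ℝ}

lemma IsAdmissibleOn.ae_environment_mem_Icc (hG : IsAdmissibleOn G a b α) :
    ∀ᵐ t ∂environment d G, ∀ e, t e ∈ Set.Icc a b :=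
  ae_infinitePi_of_ae fun _ => hG.ae_mem_Icc

lemma IsAdmissibleOn.sum_measure_mem_geodesicEdges_le (hG : IsAdmissibleOn G a b α) (ha : 0 < a)
    (x y : Fin d → ℤ) (e : Edge d) (R : ℕ) :
    ∑ u ∈ cube d R, environment d G {t | (translateEdge u).symm e ∈ geodesicEdges t x y} ≤
      (⌊b / a * (2 * (d * R + 1 : ℕ))⌋₊ + 1 : ℕ) := by
  classical
  have := hG.nullSingletonClass
  have hm (u : Fin d → ℤ) := measurableSet_mem_geodesicEdges x y ((translateEdge u).symm e)
  simp only [← lintegral_indicator_one (hm _)]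
  rw [← lintegral_finsetSum _ fun u _ => measurable_one.indicator (hm u)]
  refine (lintegral_mono_ae ?_).trans_eq (by rw [lintegral_const, measure_univ, mul_one])
  filter_upwards [hG.ae_environment_mem_Icc, ae_geodesicEdges_eq x y] with t ht huniq
  obtain ⟨p, hp⟩ := exists_isGeodesic ha (fun e => (ht e).1) x y
  have hcard := hp.card_translates_le ha (fun e => (ht e).1) (fun e => (ht e).2) e R
  refine le_trans (le_of_eq ?_) (Nat.cast_le.2 hcard)
  simp only [Finset.card_filter, Nat.cast_sum, Set.indicator_apply, Set.mem_ofPred_eq, huniq p hp,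
    Pi.one_apply, Nat.cast_ite, Nat.cast_one, Nat.cast_zero]

/-- Translating back by `u`, the left-hand side counts for each edge those of its translates which
lie on one and the same geodesic. -/
lemma IsAdmissibleOn.sum_lintegral_geodesicWeight_le (hG : IsAdmissibleOn G a b α) (ha : 0 < a)
    (q : Edge d → ℝ≥0) (x y : Fin d → ℤ) (R : ℕ) :
    ∑ u ∈ cube d R, ∫⁻ t, geodesicWeight q (x + u) (y + u) t ∂environment d G ≤
      (⌊b / a * (2 * (d * R + 1 : ℕ))⌋₊ + 1 : ℕ) * ∑' e, (q e : ℝ≥0∞) := by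
  simp only [lintegral_geodesicWeight, environment_mem_geodesicEdges_add]
  rw [← Summable.tsum_finsetSum fun _ _ => ENNReal.summable, ← ENNReal.tsum_mul_left]
  refine ENNReal.tsum_le_tsum fun e => ?_
  rw [← Finset.mul_sum, mul_comm]
  exact mul_le_mul_left (hG.sum_measure_mem_geodesicEdges_le ha x y e R) _

end GeodesicWeight

section ExceptionalEvent

variable {d : ℕ} {x y : Fin d → ℤ}

open Classical in
lemma measure_card_le_two_mul_card_filter_le {ι X : Type*} [MeasurableSpace X] {μ : Measure X}
    [IsProbabilityMeasure μ] {B : Set X} (hB : MeasurableSet B) {η : ℝ≥0∞} (hη : η ≤ 1)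
    (hμ : μ B ≤ η ^ 2) (W : Finset ι) :
    Measure.infinitePi (fun _ : ι => μ) {t | W.card ≤ 2 * (W.filter fun i => t i ∈ B).card} ≤
      (2 * η) ^ W.card := by
  set 𝒮 := W.powerset.filter fun S => W.card ≤ 2 * S.card
  have hsub : {t : ι → X | W.card ≤ 2 * (W.filter fun i => t i ∈ B).card} ⊆
      ⋃ S ∈ 𝒮, (S : Set ι).pi fun _ => B := by
    intro t ht
    simp only [Set.mem_iUnion]
    exact ⟨W.filter fun i => t i ∈ B, Finset.mem_filter.2
      ⟨Finset.mem_powerset.2 (Finset.filter_subset _ _), ht⟩,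
      fun i hi => (Finset.mem_filter.1 hi).2⟩
  have hS : ∀ S ∈ 𝒮, Measure.infinitePi (fun _ : ι => μ) ((S : Set ι).pi fun _ => B) ≤
      η ^ W.card := by
    intro S hS
    rw [Measure.infinitePi_pi _ fun _ _ => hB, Finset.prod_const]
    calc μ B ^ S.card ≤ (η ^ 2) ^ S.card := pow_le_pow_left' hμ _
      _ = η ^ (2 * S.card) := (pow_mul _ _ _).symm
      _ ≤ η ^ W.card := pow_le_pow_right_of_le_one' hη (Finset.mem_filter.1 hS).2
  have hcard : 𝒮.card ≤ 2 ^ W.card := (Finset.card_filter_le _ _).trans_eq (Finset.card_powerset W)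
  calc _ ≤ ∑ S ∈ 𝒮, Measure.infinitePi (fun _ : ι => μ) ((S : Set ι).pi fun _ => B) :=
        (measure_mono hsub).trans (measure_biUnion_finset_le _ _)
    _ ≤ 𝒮.card * η ^ W.card := (Finset.sum_le_card_nsmul _ _ _ hS).trans_eq (nsmul_eq_mul _ _)
    _ ≤ 2 ^ W.card * η ^ W.card := mul_le_mul_left (by exact_mod_cast hcard) _
    _ = (2 * η) ^ W.card := (mul_pow _ _ _).symm

/-- The edge from `x` in a given direction. -/
def stepEdge (x : Fin d → ℤ) (s : Fin d × Bool) : Edge d :=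
  ⟨s(x, x + step s), (lattice d).mem_edgeSet.2 (lattice_adj_iff_exists_step.2 ⟨s, rfl⟩)⟩

/-- The edges of the walk which starts at `x` and follows the given steps. -/
def wordEdges : (Fin d → ℤ) → List (Fin d × Bool) → List (Edge d)
  | _, [] => []
  | x, s :: w => stepEdge x s :: wordEdges (x + step s) w

lemma exists_wordEdges_eq (p : (lattice d).Walk x y) :
    ∃ w : List.Vector (Fin d × Bool) p.length, wordEdges x w.1 = walkEdges p := by
  induction p with
  | nil => exact ⟨.nil, rfl⟩
  | @cons x z y h p ih =>
    obtain ⟨s, rfl⟩ := lattice_adj_iff_exists_step.1 h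
    obtain ⟨w, hw⟩ := ih
    exact ⟨w.cons s, congrArg (stepEdge x s :: ·) hw⟩

open Classical in
/-- The event that some walk of length `L` which starts in the cube of radius `R` and has no
repeated edge has at least half of its weights in `B`. -/
def exceptionalEvent (d : ℕ) (B : Set ℝ) (L R : ℕ) : Set (Edge d → ℝ) :=
  {t | ∃ x ∈ cube d R, ∃ y, ∃ p : (lattice d).Walk x y, p.length = L ∧ (walkEdges p).Nodup ∧
    L ≤ 2 * (walkEdges p).countP fun e => t e ∈ B}

variable {G : Measure ℝ} [IsProbabilityMeasure G] {B : Set ℝ} {η : ℝ≥0∞}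

open Classical in
lemma environment_length_le_two_mul_countP_le (hB : MeasurableSet B) (hη : η ≤ 1)
    (hGB : G B ≤ η ^ 2) {l : List (Edge d)} (hl : l.Nodup) :
    environment d G {t | l.length ≤ 2 * l.countP fun e => t e ∈ B} ≤ (2 * η) ^ l.length := by
  convert measure_card_le_two_mul_card_filter_le hB hη hGB l.toFinset using 5
  · exact (List.toFinset_card_of_nodup hl).symm
  · rw [List.countP_eq_length_filter, ← List.toFinset_card_of_nodup (hl.filter _),
      List.toFinset_filter]
    simp
  · exact (List.toFinset_card_of_nodup hl).symm

open Classical in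
lemma environment_exceptionalEvent_le (hB : MeasurableSet B) (hη : η ≤ 1) (hGB : G B ≤ η ^ 2)
    (L R : ℕ) :
    environment d G (exceptionalEvent d B L R) ≤ (2 * R + 1) ^ d * (4 * d * η) ^ L := by
  let A (x : Fin d → ℤ) (w : List.Vector (Fin d × Bool) L) : Set (Edge d → ℝ) :=
    {t | (wordEdges x w.1).length = L ∧ (wordEdges x w.1).Nodup ∧
      L ≤ 2 * (wordEdges x w.1).countP fun e => t e ∈ B}
  have hsub : exceptionalEvent d B L R ⊆ ⋃ x ∈ cube d R, ⋃ w ∈ Finset.univ, A x w := by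
    rintro t ⟨x, hx, y, p, rfl, hnd, ht⟩
    obtain ⟨w, hw⟩ := exists_wordEdges_eq p
    simp only [Set.mem_iUnion]
    exact ⟨x, hx, w, Finset.mem_univ w, by rw [hw, length_walkEdges], by rwa [hw], by rwa [hw]⟩
  have hA (x w) : environment d G (A x w) ≤ (2 * η) ^ L := by
    by_cases h : (wordEdges x w.1).length = L ∧ (wordEdges x w.1).Nodup
    · refine (measure_mono fun t ht => ?_).trans
        ((environment_length_le_two_mul_countP_le hB hη hGB h.2).trans_eq (by rw [h.1]))
      exact h.1.trans_le ht.2.2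
    · rw [show A x w = ∅ from Set.eq_empty_of_forall_notMem fun t ht => h ⟨ht.1, ht.2.1⟩]
      simp
  calc _ ≤ ∑ x ∈ cube d R, ∑ w : List.Vector (Fin d × Bool) L, environment d G (A x w) :=
        (measure_mono hsub).trans ((measure_biUnion_finset_le _ _).trans
          (Finset.sum_le_sum fun x _ => measure_biUnion_finset_le _ _))
    _ ≤ ∑ x ∈ cube d R, ∑ w : List.Vector (Fin d × Bool) L, (2 * η) ^ L :=
        Finset.sum_le_sum fun x _ => Finset.sum_le_sum fun w _ => hA x w
    _ = (2 * R + 1) ^ d * (4 * d * η) ^ L := by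
        simp only [Finset.sum_const, card_cube, Finset.card_univ, card_vector, Fintype.card_prod,
          Fintype.card_fin, Fintype.card_bool, nsmul_eq_mul]
        push_cast
        rw [← mul_pow]
        congr 2
        ring

end ExceptionalEvent

section Windows

variable {β : Type*} {f : β → ℝ} {bad : β → Bool} {K : ℝ} {L : ℕ}

lemma mul_length_sub_countP_le_sum {m : ℝ} {l : List β} (h : ∀ e ∈ l, m ≤ f e) :
    m * (l.length - l.countP bad) ≤ (l.map fun e => if bad e then 0 else f e).sum := by
  induction l with
  | nil => simp
  | cons e l ih =>
    have ih' := ih fun e he => h e (List.mem_cons_of_mem _ he)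
    have he := h e List.mem_cons_self
    rw [List.map_cons, List.sum_cons, List.length_cons, List.countP_cons]
    split_ifs with hb <;> push_cast <;> linarith

lemma sum_le_mul_sum_good_of_near (hK : 0 < K) (hf : ∀ e, 0 ≤ f e) {l : List β} {m : ℝ}
    (hm : 0 ≤ m) (hLl : L ≤ l.length) (hl : l.length ≤ 2 * L)
    (hnear : ∀ e ∈ l, f e ≤ K * m ∧ m ≤ K * f e) (hbad : 2 * (l.take L).countP bad ≤ L) :
    (l.map f).sum ≤ 4 * K ^ 2 * (l.map fun e => if bad e then 0 else f e).sum := by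
  have upper : (l.map f).sum ≤ 2 * L * (K * m) := by
    have h := List.sum_le_card_nsmul (l.map f) (K * m) (by simpa using fun e he => (hnear e he).1)
    rw [nsmul_eq_mul, List.length_map] at h
    exact h.trans (mul_le_mul_of_nonneg_right (by exact_mod_cast hl) (by positivity))
  have lower : m / K * (L / 2) ≤ ((l.take L).map fun e => if bad e then 0 else f e).sum := by
    have h := mul_length_sub_countP_le_sum (f := f) (bad := bad) (m := m / K) (l := l.take L)
      fun e he => (div_le_iff₀' hK).2 (hnear e (List.mem_of_mem_take he)).2
    rw [List.length_take, min_eq_left hLl] at h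
    refine le_trans (mul_le_mul_of_nonneg_left ?_ (by positivity)) h
    have : (2 : ℝ) * (l.take L).countP bad ≤ L := by exact_mod_cast hbad
    linarith
  have mono : ((l.take L).map fun e => if bad e then 0 else f e).sum ≤
      (l.map fun e => if bad e then 0 else f e).sum := by
    refine List.Sublist.sum_le_sum ((List.take_sublist L l).map _) fun z hz => ?_
    obtain ⟨e, -, rfl⟩ := List.mem_map.1 hz
    split_ifs
    exacts [le_rfl, hf e]
  calc (l.map f).sum ≤ 4 * K ^ 2 * (m / K * (L / 2)) := upper.trans_eq (by field_simp; ring)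
    _ ≤ _ := mul_le_mul_of_nonneg_left (lower.trans mono) (by positivity)

/-- Cut the list into windows of length between `L` and `2 * L`, on each of which `f` is nearly
constant. -/
lemma sum_le_mul_sum_good (hK : 0 < K) (hf : ∀ e, 0 ≤ f e) (hL : 0 < L) (l : List β)
    (hLl : L ≤ l.length)
    (hslow : ∀ i k, (hk : i + k < l.length) → k ≤ 2 * L →
      f l[i + k] ≤ K * f l[i] ∧ f l[i] ≤ K * f l[i + k])
    (hbad : ∀ i, i + L ≤ l.length → 2 * ((l.drop i).take L).countP bad ≤ L) :
    (l.map f).sum ≤ 4 * K ^ 2 * (l.map fun e => if bad e then 0 else f e).sum := by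
  induction hn : l.length using Nat.strong_induction_on generalizing l with
  | _ n ih =>
    subst hn
    have hpos : 0 < l.length := hL.trans_le hLl
    have hnear : ∀ e ∈ l.take (2 * L), f e ≤ K * f l[0] ∧ f l[0] ≤ K * f e := by
      intro e he
      obtain ⟨k, hk, rfl⟩ := List.mem_take_iff_getElem.1 he
      simpa using hslow 0 k (by omega) (by omega)
    have hbad0 : 2 * (l.take L).countP bad ≤ L := by simpa using hbad 0 (by omega)
    by_cases hshort : l.length ≤ 2 * L
    · rw [List.take_of_length_le hshort] at hnear
      exact sum_le_mul_sum_good_of_near hK hf (hf _) hLl hshort hnear hbad0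
    have hlen : (l.take L).length = L := by rw [List.length_take, min_eq_left hLl]
    have first := sum_le_mul_sum_good_of_near (L := L) hK hf (hf l[0]) hlen.ge
      (by omega) (fun e he => hnear e ((List.take_sublist_take_left (by omega)).subset he))
      (by rwa [List.take_take, min_self])
    have rest := ih (l.drop L).length (by rw [List.length_drop]; omega) (l.drop L)
      (by rw [List.length_drop]; omega)
      (fun i k hk hkL => by
        rw [List.length_drop] at hk
        simpa only [List.getElem_drop, add_assoc] using hslow (L + i) k (by omega) hkL)
      (fun i hi => by
        rw [List.length_drop] at hi
        rw [List.drop_drop]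
        exact hbad (L + i) (by omega)) rfl
    rw [← List.take_append_drop L l, List.map_append, List.map_append, List.sum_append,
      List.sum_append]
    linarith

end Windows

section Euclidean

variable {d : ℕ}

lemma norm_toEuclid_sub_le (x y : Fin d → ℤ) : ‖toEuclid x - toEuclid y‖ ≤ l1dist x y := by
  have h : toEuclid x - toEuclid y = ∑ i, EuclideanSpace.single i ((x i - y i : ℤ) : ℝ) := by
    ext j
    simp [toEuclid, Finset.sum_apply]
  rw [h, l1dist, Nat.cast_sum]
  refine (norm_sum_le _ _).trans (Finset.sum_le_sum fun i _ => ?_)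
  rw [PiLp.norm_single, Real.norm_eq_abs, Nat.cast_natAbs, Int.cast_abs]

lemma norm_toEuclid_le (v : Fin d → ℤ) : ‖toEuclid v‖ ≤ l1dist 0 v := by
  have h0 : toEuclid (0 : Fin d → ℤ) = 0 := by
    ext i
    simp [toEuclid]
  have := norm_toEuclid_sub_le v 0
  rwa [h0, sub_zero, l1dist_comm] at this

lemma floor_log_norm_le_l1dist (v : Fin d → ℤ) : ⌊Real.log ‖toEuclid v‖⌋₊ ≤ l1dist 0 v :=
  Nat.floor_le_of_le ((Real.log_le_self (norm_nonneg _)).trans (norm_toEuclid_le v))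

lemma l1dist_zero_le (v : Fin d → ℤ) : (l1dist 0 v : ℝ) ≤ d * ‖toEuclid v‖ := by
  have h : ∀ i ∈ (Finset.univ : Finset (Fin d)),
      (((((0 : Fin d → ℤ) i - v i).natAbs : ℕ) : ℝ)) ≤ ‖toEuclid v‖ := by
    intro i _
    refine le_trans (le_of_eq ?_) (PiLp.norm_apply_le (toEuclid v) i)
    rw [Nat.cast_natAbs, Int.cast_abs, Real.norm_eq_abs]
    simp [toEuclid]
  rw [l1dist, Nat.cast_sum]
  simpa using Finset.sum_le_card_nsmul _ _ _ h

lemma edgeDist_getElem_le {x y : Fin d → ℤ} (p : (lattice d).Walk x y) {i k : ℕ}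
    (hi : i < (walkEdges p).length) (hk : i + k < (walkEdges p).length) :
    edgeDist (walkEdges p)[i] (walkEdges p)[i + k] ≤ k := by
  have hvert (j : ℕ) : ‖toEuclid (p.getVert j) - toEuclid (p.getVert (j + k))‖ ≤ k :=
    (norm_toEuclid_sub_le _ _).trans (Nat.cast_le.2 (l1dist_getVert_le p j k))
  rw [edgeDist, val_getElem_walkEdges, val_getElem_walkEdges, dist_eq_norm]
  change ‖(2 : ℝ)⁻¹ • (toEuclid (p.getVert i) + toEuclid (p.getVert (i + 1))) -
    (2 : ℝ)⁻¹ • (toEuclid (p.getVert (i + k)) + toEuclid (p.getVert (i + k + 1)))‖ ≤ k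
  have htri := norm_add_le (toEuclid (p.getVert i) - toEuclid (p.getVert (i + k)))
    (toEuclid (p.getVert (i + 1)) - toEuclid (p.getVert (i + k + 1)))
  have hnext := hvert (i + 1)
  rw [add_right_comm] at hnext
  rw [← smul_sub, add_sub_add_comm, norm_smul, Real.norm_eq_abs, abs_of_pos (by norm_num)]
  linarith [hvert i]

end Euclidean

section Comparison

variable {d : ℕ} {x y : Fin d → ℤ} {t t' : Edge d → ℝ} {p : (lattice d).Walk x y}

lemma getVert_mem_cube {v : Fin d → ℤ} (p : (lattice d).Walk 0 v) {R : ℕ} (hR : p.length ≤ R)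
    {i : ℕ} (hi : i ≤ p.length) : p.getVert i ∈ cube d R := by
  have := l1dist_getVert_le p 0 i
  rw [SimpleGraph.Walk.getVert_zero, zero_add] at this
  exact mem_cube_of_l1dist_le (this.trans (hi.trans hR))

/-- The edges of the lattice with both ends in `cube d R`. -/
noncomputable def cubeEdges (d R : ℕ) : Finset (Edge d) :=
  (cube d R).sym2.preimage Subtype.val Subtype.val_injective.injOn

lemma mem_cubeEdges_of_mem_walkEdges {v : Fin d → ℤ} {p : (lattice d).Walk 0 v} {R : ℕ}
    (hR : p.length ≤ R) {e : Edge d} (he : e ∈ walkEdges p) : e ∈ cubeEdges d R := by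
  obtain ⟨i, hi, rfl⟩ := List.mem_iff_getElem.1 he
  have hip : i < p.length := by simpa using hi
  rw [cubeEdges, Finset.mem_preimage, val_getElem_walkEdges, Finset.mk_mem_sym2_iff]
  exact ⟨getVert_mem_cube p hR hip.le, getVert_mem_cube p hR hip⟩

open Classical in
lemma two_mul_countP_le_of_notMem_exceptionalEvent {B : Set ℝ} {L R : ℕ}
    (ht : t ∉ exceptionalEvent d B L R) (hx : x ∈ cube d R) (hL : p.length = L)
    (hnd : (walkEdges p).Nodup) :
    2 * (walkEdges p).countP (fun e => t e ∈ B) ≤ L := by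
  by_contra! h
  exact ht ⟨x, hx, y, p, hL, hnd, h.le⟩

open Classical in
lemma IsLogSmooth.passageTime_le_mul_good {B : Set ℝ} {L R : ℕ} (hL : 0 < L)
    (ht : t ∉ exceptionalEvent d B L R) (hnd : (walkEdges p).Nodup) (hLp : L ≤ p.length)
    (hR : ∀ i ≤ p.length, p.getVert i ∈ cube d R) {n : ℝ} (hLn : (L : ℝ) ≤ Real.log n)
    {q : Edge d → ℝ≥0} (hq : IsLogSmooth n q) :
    passageTime (fun e => (q e : ℝ)) p ≤
      400 * passageTime (fun e => if t e ∈ B then 0 else (q e : ℝ)) p := by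
  have hslow : ∀ i k, (hk : i + k < (walkEdges p).length) → k ≤ 2 * L →
      (q (walkEdges p)[i + k] : ℝ) ≤ 10 * q (walkEdges p)[i] ∧
        (q (walkEdges p)[i] : ℝ) ≤ 10 * q (walkEdges p)[i + k] := by
    intro i k hk hkL
    have hk2 : (k : ℝ) ≤ 2 * L := by exact_mod_cast hkL
    have hnear := hq (walkEdges p)[i] (walkEdges p)[i + k]
      ((edgeDist_getElem_le p (by omega) hk).trans (by linarith))
    simp only [← NNReal.coe_le_coe, NNReal.coe_mul] at hnear
    push_cast at hnear
    exact ⟨by linarith [hnear.1], hnear.2⟩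
  have hbad : ∀ i, i + L ≤ (walkEdges p).length →
      2 * (((walkEdges p).drop i).take L).countP (fun e => t e ∈ B) ≤ L := by
    intro i hi
    rw [length_walkEdges] at hi
    rw [← walkEdges_drop, ← walkEdges_take]
    refine two_mul_countP_le_of_notMem_exceptionalEvent ht (hR i (by omega)) ?_ ?_
    · rw [SimpleGraph.Walk.take_length, SimpleGraph.Walk.drop_length]
      omega
    · rw [walkEdges_take, walkEdges_drop]
      exact hnd.sublist ((List.take_sublist _ _).trans (List.drop_sublist _ _))
  have key := sum_le_mul_sum_good (by norm_num : (0 : ℝ) < 10) (fun e => (q e).coe_nonneg) hL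
    (walkEdges p) (by simpa using hLp) hslow hbad
  rw [passageTime_eq, passageTime_eq]
  norm_num at key
  exact key

/-- The comparison behind the theorem: a geodesic of the shifted environment gains no more from the
shift than any geodesic of the original one between nearby endpoints. -/
lemma IsGeodesic.mul_passageTime_le {b A κ : ℝ} (hb : 0 ≤ b) (htb : ∀ e, t e ≤ b)
    (htb' : ∀ e, t' e ≤ b) {f g : Edge d → ℝ} (hp : IsGeodesic t' p) {R : ℕ} {u : Fin d → ℤ}
    (hu : u ∈ cube d R) {p₀ : (lattice d).Walk (x + u) (y + u)} (hp₀ : IsGeodesic t p₀)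
    (hlower : ∀ e ∈ walkEdges p, t e + κ * g e ≤ t' e) (hupper : ∀ e, t' e ≤ t e + A * f e) :
    κ * passageTime g p ≤ A * passageTime f p₀ + 4 * b * d * R := by
  have hgain := passageTime_mono hlower
  have hcost := passageTime_mono (p := p₀) fun e _ => hupper e
  rw [passageTime_add_const_mul] at hgain hcost
  have hsub := IsGeodesic.passageTime_sub_le htb htb' hp hp₀
  have hdist (z : Fin d → ℤ) : (l1dist z (z + u) : ℝ) ≤ d * R := by
    exact_mod_cast l1dist_add_le_of_mem_cube hu z
  have := mul_le_mul_of_nonneg_left (add_le_add (hdist x) (hdist y)) (mul_nonneg zero_le_two hb)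
  linarith

end Comparison

section WeakType

variable {d : ℕ} {G : Measure ℝ} [IsProbabilityMeasure G] {a b α : ℝ} {x y : Fin d → ℤ}

/-- Markov's inequality for all translates of the two endpoints by a vector of sup norm at most `r`
at once, divided by the number of translates of an edge that a geodesic can meet. -/
lemma IsAdmissibleOn.pow_mul_measure_le (hG : IsAdmissibleOn G a b α) (ha : 0 < a) (hd : 1 ≤ d)
    (q : Edge d → ℝ≥0) {S : Set (Edge d → ℝ)} {r : ℝ} {m : ℝ≥0∞}
    (hS : ∀ u ∈ cube d ⌊r⌋₊, ∀ᵐ t ∂environment d G, t ∈ S →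
      m ≤ geodesicWeight q (x + u) (y + u) t) :
    ENNReal.ofReal r ^ (d - 1) * m * environment d G S ≤
      ENNReal.ofReal (b / a * (d + 2) + 1) * ∑' e, (q e : ℝ≥0∞) := by
  set R : ℕ := ⌊r⌋₊
  have hb : 0 < b := ha.trans hG.lt
  have hmarkov : ∀ u ∈ cube d R, m * environment d G S ≤
      ∫⁻ t, geodesicWeight q (x + u) (y + u) t ∂environment d G := fun u hu =>
    (mul_le_mul_right (measure_mono_ae (hS u hu)) _).trans
      (mul_meas_ge_le_lintegral (measurable_geodesicWeight q (x + u) (y + u)) _)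
  have hsum := (Finset.card_nsmul_le_sum _ _ _ hmarkov).trans
    (hG.sum_lintegral_geodesicWeight_le ha q x y R)
  have hcount : ((⌊b / a * (2 * (d * R + 1 : ℕ))⌋₊ + 1 : ℕ) : ℝ≥0∞) ≤
      (2 * R + 1 : ℕ) * ENNReal.ofReal (b / a * (d + 2) + 1) := by
    rw [← ENNReal.ofReal_natCast, ← ENNReal.ofReal_natCast,
      ← ENNReal.ofReal_mul (Nat.cast_nonneg _)]
    refine ENNReal.ofReal_le_ofReal ?_
    have hfloor := Nat.floor_le (show 0 ≤ b / a * (2 * (d * R + 1 : ℕ)) by positivity)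
    have hrest : 0 ≤ b / a * ((R : ℝ) * 4 + d) := by positivity
    push_cast at hfloor ⊢
    linarith [(Nat.cast_nonneg R : (0 : ℝ) ≤ R)]
  have hdiv : ((2 * R + 1 : ℕ) : ℝ≥0∞) ^ (d - 1) * (m * environment d G S) ≤
      ENNReal.ofReal (b / a * (d + 2) + 1) * ∑' e, (q e : ℝ≥0∞) := by
    rw [← ENNReal.mul_le_mul_iff_right (Nat.cast_ne_zero.2 (by omega : 2 * R + 1 ≠ 0))
      (ENNReal.natCast_ne_top _), ← mul_assoc, ← pow_succ', Nat.sub_add_cancel hd, ← mul_assoc,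
      ← Nat.cast_pow, ← card_cube]
    rw [nsmul_eq_mul, ← mul_assoc] at hsum
    exact hsum.trans ((mul_le_mul_left hcount _).trans_eq (mul_assoc _ _ _))
  refine le_trans ?_ hdiv
  rw [mul_assoc]
  gcongr
  rw [ENNReal.ofReal_le_iff_le_toReal (ENNReal.natCast_ne_top _), ENNReal.toReal_natCast]
  have := Nat.lt_floor_add_one r
  push_cast
  linarith [(Nat.cast_nonneg R : (0 : ℝ) ≤ R)]

end WeakType

section WeakL2

variable {X : Type*} [MeasurableSpace X] {μ : Measure X} {f w : X → ℝ≥0∞}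

lemma mul_le_one_add_pow_three_add_tsum {x w : ℝ≥0∞} (hx : x ≠ ⊤) :
    x * w ≤ 1 + 4 * w ^ 3 + ∑' k : ℕ, 4 * 8 ^ k * {z | 4 ^ k ≤ z}.indicator 1 x := by
  rcases lt_or_ge x 1 with hx1 | hx1
  · refine le_trans (mul_le_of_le_one_left' hx1.le) (le_trans ?_ le_self_add)
    rcases le_total w 1 with hw | hw
    · exact hw.trans le_self_add
    · exact (le_self_pow₀ hw three_ne_zero).trans
        ((le_mul_of_one_le_left' (by norm_num)).trans le_add_self)
  · lift x to ℝ≥0 using hx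
    obtain ⟨k, hk, hk'⟩ := exists_nat_pow_near (show 1 ≤ x by exact_mod_cast hx1)
      (show (1 : ℝ≥0) < 4 by norm_num)
    have hlow : (4 : ℝ≥0∞) ^ k ≤ x := by exact_mod_cast hk
    have hupp : (x : ℝ≥0∞) ≤ 4 * 4 ^ k := by
      rw [← pow_succ']
      exact_mod_cast hk'.le
    rcases le_total w (2 ^ k) with hw | hw
    · refine le_trans (le_trans ?_ (ENNReal.le_tsum k)) le_add_self
      rw [Set.indicator_of_mem (Set.mem_ofPred_eq ▸ hlow), Pi.one_apply, mul_one]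
      calc (x : ℝ≥0∞) * w ≤ 4 * 4 ^ k * 2 ^ k := mul_le_mul' hupp hw
        _ = 4 * 8 ^ k := by rw [mul_assoc, ← mul_pow]; norm_num
    · refine le_trans (le_trans ?_ le_add_self) le_self_add
      calc (x : ℝ≥0∞) * w ≤ 4 * (2 ^ k * 2 ^ k) * w := by
            gcongr
            exact hupp.trans_eq (by rw [← mul_pow]; norm_num)
        _ ≤ 4 * (w * w) * w := by gcongr
        _ = 4 * w ^ 3 := by ring

lemma lintegral_mul_le_of_measure_le (hf : Measurable f) (hw : Measurable w)
    (hfin : ∀ᵐ z ∂μ, f z ≠ ⊤) (hμ : μ Set.univ ≤ 1) (hw3 : ∫⁻ z, w z ^ 3 ∂μ ≤ 2)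
    (htail : ∀ k : ℕ, μ {z | 4 ^ k ≤ f z} ≤ (16 ^ k)⁻¹) : ∫⁻ z, f z * w z ∂μ ≤ 17 := by
  have hlevel (k : ℕ) : MeasurableSet {z | 4 ^ k ≤ f z} := measurableSet_le measurable_const hf
  have hterm (k : ℕ) : Measurable fun z =>
      4 * 8 ^ k * {z | 4 ^ k ≤ f z}.indicator (1 : X → ℝ≥0∞) z :=
    (measurable_one.indicator (hlevel k)).const_mul _
  have hgeom : ∑' k : ℕ, 4 * 8 ^ k * μ {z | 4 ^ k ≤ f z} ≤ 8 := by
    have hk (k : ℕ) : 4 * 8 ^ k * μ {z | 4 ^ k ≤ f z} ≤ 4 * (2 : ℝ≥0∞)⁻¹ ^ k :=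
      calc 4 * 8 ^ k * μ {z | 4 ^ k ≤ f z} ≤ 4 * 8 ^ k * (16 ^ k)⁻¹ := by gcongr; exact htail k
        _ = 4 * (8 * (8 * 2)⁻¹) ^ k := by rw [mul_pow, ENNReal.inv_pow, mul_assoc]; norm_num
        _ = 4 * (2 : ℝ≥0∞)⁻¹ ^ k := by
          rw [ENNReal.mul_inv (by norm_num) (by norm_num), ← mul_assoc,
            ENNReal.mul_inv_cancel (by norm_num) (by norm_num), one_mul]
    refine (ENNReal.tsum_le_tsum hk).trans_eq ?_
    rw [ENNReal.tsum_mul_left, ENNReal.tsum_geometric, ENNReal.one_sub_inv_two, inv_inv]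
    norm_num
  calc ∫⁻ z, f z * w z ∂μ
      ≤ ∫⁻ z, (1 + 4 * w z ^ 3 +
          ∑' k : ℕ, 4 * 8 ^ k * {z | 4 ^ k ≤ f z}.indicator (1 : X → ℝ≥0∞) z) ∂μ :=
        lintegral_mono_ae (hfin.mono fun z hz => mul_le_one_add_pow_three_add_tsum hz)
    _ = μ Set.univ + 4 * ∫⁻ z, w z ^ 3 ∂μ + ∑' k : ℕ, 4 * 8 ^ k * μ {z | 4 ^ k ≤ f z} := by
        rw [lintegral_add_right _ (Measurable.tsum hterm), lintegral_add_left measurable_const,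
          lintegral_one, lintegral_const_mul _ (hw.pow_const 3),
          lintegral_tsum fun k => (hterm k).aemeasurable]
        simp only [lintegral_const_mul _ (measurable_one.indicator (hlevel _)),
          lintegral_indicator_one (hlevel _)]
    _ ≤ 1 + 4 * 2 + 8 := by gcongr
    _ = 17 := by norm_num

lemma setLIntegral_mul_le_of_le {K : ℝ≥0∞} (hK : 1 ≤ K) (hfK : ∀ᵐ z ∂μ, f z ≤ K) {F : Set X}
    (hF : K ^ 2 * μ F ≤ 1) (hw3 : ∫⁻ z, w z ^ 3 ∂μ ≤ 2) : ∫⁻ z in F, f z * w z ∂μ ≤ 3 := by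
  have hpt : ∀ᵐ z ∂μ.restrict F, f z * w z ≤ K ^ 2 + w z ^ 3 := by
    filter_upwards [ae_restrict_of_ae hfK] with z hz
    rcases le_total (w z) K with hw | hw
    · exact (mul_le_mul' hz hw).trans (by rw [← sq]; exact le_self_add)
    · calc f z * w z ≤ w z ^ 2 := by rw [sq]; gcongr; exact hz.trans hw
        _ ≤ w z ^ 3 := pow_le_pow_right₀ (hK.trans hw) (by norm_num)
        _ ≤ K ^ 2 + w z ^ 3 := le_add_self
  calc ∫⁻ z in F, f z * w z ∂μ ≤ ∫⁻ z in F, (K ^ 2 + w z ^ 3) ∂μ := lintegral_mono_ae hpt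
    _ = K ^ 2 * μ F + ∫⁻ z in F, w z ^ 3 ∂μ := by
        rw [lintegral_add_left measurable_const, setLIntegral_const]
    _ ≤ 1 + 2 := add_le_add hF ((setLIntegral_le_lintegral F _).trans hw3)
    _ = 3 := by norm_num

lemma lintegral_mul_le_of_weak_type [IsProbabilityMeasure μ] (hf : Measurable f)
    (hw : Measurable w) (hw3 : ∫⁻ z, w z ^ 3 ∂μ ≤ 2) {K M : ℝ≥0∞} (hM : M ≠ 0) (hM' : M ≠ ⊤)
    (hK : 1 ≤ K) (hK' : K ≠ ⊤) (hfK : ∀ᵐ z ∂μ, f z ≤ K * M) {F : Set X} (hF : K ^ 2 * μ F ≤ 1)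
    (htail : ∀ k : ℕ, μ (Fᶜ ∩ {z | 4 ^ k * M ≤ f z}) ≤ (16 ^ k)⁻¹) :
    ∫⁻ z, f z * w z ∂μ ≤ 20 * M := by
  have hgK : ∀ᵐ z ∂μ, f z / M ≤ K := hfK.mono fun z hz => ENNReal.div_le_of_le_mul hz
  have hF' := measurableSet_toMeasurable μ F
  have hgtail (k : ℕ) : μ.restrict (toMeasurable μ F)ᶜ {z | 4 ^ k ≤ f z / M} ≤ (16 ^ k)⁻¹ := by
    simp only [ENNReal.le_div_iff_mul_le (.inl hM) (.inl hM')]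
    rw [Measure.restrict_apply' hF'.compl, Set.inter_comm]
    exact (measure_mono (Set.inter_subset_inter_left _
      (Set.compl_subset_compl.2 (subset_toMeasurable μ F)))).trans (htail k)
  have hbad := setLIntegral_mul_le_of_le hK hgK (by rwa [measure_toMeasurable]) hw3
  have hgood := lintegral_mul_le_of_measure_le (μ := μ.restrict (toMeasurable μ F)ᶜ)
    (hf.div_const M) hw
    (ae_restrict_of_ae (hgK.mono fun z hz => ne_top_of_le_ne_top hK' hz))
    (by rw [Measure.restrict_apply_univ]; exact prob_le_one)
    ((setLIntegral_le_lintegral _ _).trans hw3) hgtail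
  calc ∫⁻ z, f z * w z ∂μ = (∫⁻ z, f z / M * w z ∂μ) * M := by
        rw [← lintegral_mul_const' _ _ hM']
        simp only [mul_right_comm, ENNReal.div_mul_cancel hM hM']
    _ ≤ (3 + 17) * M := by
        rw [← lintegral_add_compl _ hF']
        gcongr
    _ = 20 * M := by norm_num

end WeakL2

section EnvironmentShift

variable {d : ℕ} {G : Measure ℝ} [IsProbabilityMeasure G] {a b α : ℝ}

/-- The shift of the whole environment used in the proof: inside `cube d R` the weight of `e` is
shifted by the amount `q e`, outside it is kept. -/
noncomputable def envShift (G : Measure ℝ) (a b : ℝ) (R : ℕ) (q : Edge d → ℝ≥0)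
    (t : Edge d → ℝ) : Edge d → ℝ :=
  fun e => siteShift G a b ((cubeEdges d R : Set (Edge d)).indicator (fun e => (q e : ℝ)) e) (t e)

lemma prod_one_add_le_two {ι : Type*} (s : Finset ι) (f : ι → ℝ) (hf : ∀ i, 0 ≤ f i)
    (hs : ∑ i ∈ s, f i ≤ 1 / 4) : ∏ i ∈ s, ENNReal.ofReal (1 + f i) ≤ 2 := by
  rw [← ENNReal.ofReal_prod_of_nonneg fun i _ => by linarith [hf i], ← ENNReal.ofReal_ofNat]
  refine ENNReal.ofReal_le_ofReal ?_
  calc ∏ i ∈ s, (1 + f i) ≤ ∏ i ∈ s, Real.exp (f i) :=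
        Finset.prod_le_prod (fun i _ => by linarith [hf i])
          fun i _ => by linarith [Real.add_one_le_exp (f i)]
    _ = Real.exp (∑ i ∈ s, f i) := (Real.exp_sum _ _).symm
    _ ≤ Real.exp (Real.log 2) := Real.exp_le_exp.2 (by linarith [Real.log_two_gt_d9])
    _ = 2 := Real.exp_log two_pos

lemma indicator_coe_le_one {q : Edge d → ℝ≥0} (hq : ∀ e, q e ≤ 1) (s : Set (Edge d)) (e : Edge d) :
    s.indicator (fun e => (q e : ℝ)) e ≤ 1 :=
  Set.indicator_apply_le' (fun _ => by exact_mod_cast hq e) fun _ => zero_le_one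

lemma IsAdmissibleOn.le_envShift (hG : IsAdmissibleOn G a b α) {q : Edge d → ℝ≥0}
    (hq : ∀ e, q e ≤ 1) (R : ℕ) {t : Edge d → ℝ} (ht : ∀ e, t e ∈ Set.Icc a b) (e : Edge d) :
    t e ≤ envShift G a b R q t e :=
  hG.le_siteShift (Set.indicator_nonneg (fun e _ => (q e).coe_nonneg) e)
    (indicator_coe_le_one hq _ e) (ht e)

lemma IsAdmissibleOn.envShift_le (hG : IsAdmissibleOn G a b α) {q : Edge d → ℝ≥0}
    (hq : ∀ e, q e ≤ 1) (R : ℕ) {t : Edge d → ℝ} (ht : ∀ e, t e ∈ Set.Icc a b) (e : Edge d) :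
    envShift G a b R q t e ≤ t e + α⁻¹ * q e := by
  have hτ := Set.indicator_nonneg (s := (cubeEdges d R : Set (Edge d)))
    (fun e _ => (q e).coe_nonneg) e
  refine (hG.siteShift_le hτ (indicator_coe_le_one hq _ e) (ht e)).trans ?_
  rw [div_eq_inv_mul]
  have := inv_nonneg.2 hG.pos.le
  gcongr
  exact Set.indicator_le_self' (fun e _ => (q e).coe_nonneg) e

lemma sum_indicator_sq_le {ι : Type*} {q : ι → ℝ≥0} {c : ℝ≥0} (hq : ∑' e, (q e : ℝ≥0∞) ^ 2 ≤ c)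
    (s : Finset ι) : ∑ e ∈ s, (s : Set ι).indicator (fun e => (q e : ℝ)) e ^ 2 ≤ c := by
  have h : ∑ e ∈ s, q e ^ 2 ≤ c := by exact_mod_cast (ENNReal.sum_le_tsum s).trans hq
  refine le_trans (le_of_eq ?_) (NNReal.coe_le_coe.2 h)
  push_cast
  exact Finset.sum_congr rfl fun e he => by rw [Set.indicator_of_mem (Finset.mem_coe.2 he)]

lemma lt_one_of_tsum_sq_le {ι : Type*} {q : ι → ℝ≥0} (hq : ∑' e, (q e : ℝ≥0∞) ^ 2 ≤ (1 / 4 : ℝ≥0))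
    (e : ι) : q e < 1 := by
  have h : q e ^ 2 ≤ 1 / 4 := by exact_mod_cast (ENNReal.le_tsum e).trans hq
  exact (pow_lt_one_iff_of_nonneg zero_le two_ne_zero).1 (h.trans_lt (by norm_num))

lemma IsAdmissibleOn.exists_isDensityTransport_envShift (hG : IsAdmissibleOn G a b α)
    {q : Edge d → ℝ≥0} (hq : ∑' e, (q e : ℝ≥0∞) ^ 2 ≤ (1 / 4 : ℝ≥0)) (R : ℕ) :
    ∃ W, IsDensityTransport (environment d G) (envShift G a b R q) W ∧
      ∫⁻ t, W t ^ 3 ∂environment d G ≤ 2 := by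
  set τ := (cubeEdges d R : Set (Edge d)).indicator fun e => (q e : ℝ) with hτ
  have hτ0 (e : Edge d) : 0 ≤ τ e := Set.indicator_nonneg (fun e _ => (q e).coe_nonneg) e
  have hτ1 (e : Edge d) : τ e < 1 :=
    (Set.indicator_le_self' (fun e _ => (q e).coe_nonneg) e).trans_lt
      (by exact_mod_cast lt_one_of_tsum_sq_le hq e)
  have hsite (e : Edge d) := hG.isDensityTransport_siteShift (hτ0 e) (hτ1 e)
  refine ⟨fun t => ∏ e ∈ cubeEdges d R, siteDensity G (τ e) (t e),
    IsDensityTransport.infinitePi hsite fun e he => ?_, ?_⟩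
  · rw [hτ, Set.indicator_of_notMem (by exact_mod_cast he), siteDensity_zero]
  · simp only [← Finset.prod_pow]
    rw [lintegral_prod_infinitePi fun e => (hsite e).measurable_density.pow_const 3]
    simp only [hG.lintegral_siteDensity_pow_three (hτ0 _) (hτ1 _).le]
    exact prod_one_add_le_two _ _ (fun e => sq_nonneg _)
      (by simpa using sum_indicator_sq_le hq (cubeEdges d R))

lemma IsAdmissibleOn.ae_exists_isGeodesic (hG : IsAdmissibleOn G a b α) (ha : 0 < a)
    (q : Edge d → ℝ≥0) (x y : Fin d → ℤ) :
    ∀ᵐ t ∂environment d G, ∃ p : (lattice d).Walk x y, IsGeodesic t p ∧ (walkEdges p).Nodup ∧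
      a * p.length ≤ b * l1dist x y ∧
      geodesicWeight q x y t = ENNReal.ofReal (passageTime (fun e => (q e : ℝ)) p) := by
  have := hG.nullSingletonClass
  filter_upwards [hG.ae_environment_mem_Icc, ae_geodesicEdges_eq x y] with t ht huniq
  obtain ⟨p, hp⟩ := exists_isGeodesic ha (fun e => (ht e).1) x y
  have hnd := hp.nodup_walkEdges ha (fun e => (ht e).1) (fun e => (ht e).2)
  refine ⟨p, hp, hnd, hp.mul_length_le_mul_l1dist (fun e => (ht e).1) (fun e => (ht e).2), ?_⟩
  rw [geodesicWeight, huniq p hp, tsum_mem_walkEdges q hnd]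

open Classical in
lemma IsAdmissibleOn.le_passageTime_of_envShift (hG : IsAdmissibleOn G a b α) (ha : 0 < a)
    {κ : ℝ} (hκ : 0 < κ) {B : Set ℝ}
    (hB : ∀ t ∈ Set.Icc a b, t ∉ B → ∀ τ, 0 ≤ τ → τ ≤ 1 → t + κ * τ ≤ siteShift G a b τ t)
    {q : Edge d → ℝ≥0} (hq : ∀ e, q e ≤ 1) {R : ℕ} {t : Edge d → ℝ}
    (ht : ∀ e, t e ∈ Set.Icc a b) (hs : ∀ e, envShift G a b R q t e ∈ Set.Icc a b)
    {v : Fin d → ℤ} {p : (lattice d).Walk 0 v} (hp : IsGeodesic (envShift G a b R q t) p)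
    (hpR : p.length ≤ R)
    (hgood : passageTime (fun e => (q e : ℝ)) p ≤
      400 * passageTime (fun e => if t e ∈ B then 0 else (q e : ℝ)) p)
    {r : ℕ} {u : Fin d → ℤ} (hu : u ∈ cube d r) {p₀ : (lattice d).Walk (0 + u) (v + u)}
    (hp₀ : IsGeodesic t p₀)
    (hr : 3200 * b * d * r ≤ κ * passageTime (fun e => (q e : ℝ)) p) :
    κ * α / 800 * passageTime (fun e => (q e : ℝ)) p ≤
      passageTime (fun e => (q e : ℝ)) p₀ := by
  have hlower : ∀ e ∈ walkEdges p,
      t e + κ * (if t e ∈ B then 0 else (q e : ℝ)) ≤ envShift G a b R q t e := by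
    intro e he
    split_ifs with heB
    · simpa using hG.le_envShift hq R ht e
    · rw [envShift, Set.indicator_of_mem (mem_cubeEdges_of_mem_walkEdges hpR he)]
      exact hB _ (ht e) heB _ (q e).coe_nonneg (by exact_mod_cast hq e)
  have hcompare := IsGeodesic.mul_passageTime_le (ha.trans hG.lt).le (fun e => (ht e).2)
    (fun e => (hs e).2) hp hu hp₀ hlower (hG.envShift_le hq R ht)
  rw [← div_eq_inv_mul, ← sub_le_iff_le_add, le_div_iff₀' hG.pos] at hcompare
  refine le_trans ?_ hcompare
  rw [mul_comm κ, mul_div_assoc, mul_assoc]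
  refine mul_le_mul_of_nonneg_left ?_ hG.pos.le
  linarith [mul_le_mul_of_nonneg_left hgood hκ.le]

section ShiftedGeodesic

variable {n κ : ℝ} {B : Set ℝ} {q : Edge d → ℝ≥0} {L R : ℕ} {v : Fin d → ℤ}
  {W : (Edge d → ℝ) → ℝ≥0∞}

lemma IsAdmissibleOn.ae_le_geodesicWeight_add (hG : IsAdmissibleOn G a b α) (ha : 0 < a)
    (hκ : 0 < κ)
    (hB : ∀ t ∈ Set.Icc a b, t ∉ B → ∀ τ, 0 ≤ τ → τ ≤ 1 → t + κ * τ ≤ siteShift G a b τ t)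
    (hq : ∀ e, q e ≤ 1) (hqn : IsLogSmooth n q)
    (hW : IsDensityTransport (environment d G) (envShift G a b R q) W)
    (hL : 0 < L) (hLn : L ≤ Real.log n) (hLv : L ≤ l1dist 0 v) (hRv : b * l1dist 0 v ≤ a * R)
    {s : ℝ≥0} {r : ℕ} (hr : 3200 * b * d * r ≤ κ * s) {u : Fin d → ℤ} (hu : u ∈ cube d r) :
    ∀ᵐ t ∂environment d G,
      t ∈ (exceptionalEvent d B L R)ᶜ ∩ {t | s ≤ geodesicWeight q 0 v (envShift G a b R q t)} →
        ENNReal.ofReal (κ * α / 800 * s) ≤ geodesicWeight q (0 + u) (v + u) t := by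
  filter_upwards [hG.ae_environment_mem_Icc, hW.ae_comp hG.ae_environment_mem_Icc,
    hW.ae_comp (hG.ae_exists_isGeodesic ha q 0 v), hG.ae_exists_isGeodesic ha q (0 + u) (v + u)]
    with t ht hs ⟨p, hp, hnd, hlen, hweight⟩ ⟨p₀, hp₀, _, _, hweight₀⟩ ⟨hexc, hts⟩
  have hpR : p.length ≤ R := by exact_mod_cast le_of_mul_le_mul_left (hlen.trans hRv) ha
  have hgood := hqn.passageTime_le_mul_good hL hexc hnd (hLv.trans (l1dist_le_length p))
    (fun i hi => getVert_mem_cube p hpR hi) hLn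
  have hnonneg : 0 ≤ passageTime (fun e => (q e : ℝ)) p := by
    simpa using mul_length_le_passageTime (fun e => (q e).coe_nonneg) p
  rw [Set.mem_ofPred_eq, hweight, ← ENNReal.ofReal_coe_nnreal,
    ENNReal.ofReal_le_ofReal_iff hnonneg] at hts
  have := hG.pos
  rw [hweight₀]
  exact ENNReal.ofReal_le_ofReal ((mul_le_mul_of_nonneg_left hts (by positivity)).trans
    (hG.le_passageTime_of_envShift ha hκ hB hq ht hs hp hpR hgood hu hp₀
      (hr.trans (mul_le_mul_of_nonneg_left hts hκ.le))))

/-- The constant of the weak-type bound for the weight of the geodesic in the shifted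
environment. -/
noncomputable def weakTypeConstant (d : ℕ) (a b α κ : ℝ) : ℝ :=
  (b / a * (d + 2) + 1) / ((κ / (3200 * b * d)) ^ (d - 1) * (κ * α / 800))

lemma IsAdmissibleOn.pow_mul_measure_envShift_le (hG : IsAdmissibleOn G a b α) (ha : 0 < a)
    (hd : 1 ≤ d) (hκ : 0 < κ)
    (hB : ∀ t ∈ Set.Icc a b, t ∉ B → ∀ τ, 0 ≤ τ → τ ≤ 1 → t + κ * τ ≤ siteShift G a b τ t)
    (hq : ∀ e, q e ≤ 1) (hqn : IsLogSmooth n q)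
    (hW : IsDensityTransport (environment d G) (envShift G a b R q) W)
    (hL : 0 < L) (hLn : L ≤ Real.log n) (hLv : L ≤ l1dist 0 v) (hRv : b * l1dist 0 v ≤ a * R)
    (s : ℝ≥0) :
    s ^ d * environment d G ((exceptionalEvent d B L R)ᶜ ∩
      {t | s ≤ geodesicWeight q 0 v (envShift G a b R q t)}) ≤
        ENNReal.ofReal (weakTypeConstant d a b α κ) * ∑' e, (q e : ℝ≥0∞) := by
  have hb : 0 < b := ha.trans hG.lt
  have hα := hG.pos
  have : (0 : ℝ) < d := by exact_mod_cast hd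
  set c := (κ / (3200 * b * d)) ^ (d - 1) * (κ * α / 800)
  have hc0 : 0 < c := by positivity
  have hr : 3200 * b * d * ⌊κ / (3200 * b * d) * s⌋₊ ≤ κ * s := by
    calc 3200 * b * d * ⌊κ / (3200 * b * d) * s⌋₊
        ≤ 3200 * b * d * (κ / (3200 * b * d) * s) := by
          gcongr
          exact Nat.floor_le (by positivity)
      _ = κ * s := by field_simp
  have hweak := hG.pow_mul_measure_le ha hd q fun u hu =>
    hG.ae_le_geodesicWeight_add ha hκ hB hq hqn hW hL hLn hLv hRv hr hu
  have hscale : ENNReal.ofReal (κ / (3200 * b * d) * s) ^ (d - 1) *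
      ENNReal.ofReal (κ * α / 800 * s) = ENNReal.ofReal c * s ^ d := by
    rw [← ENNReal.ofReal_pow (by positivity), ← ENNReal.ofReal_mul (by positivity),
      ← ENNReal.ofReal_coe_nnreal, ← ENNReal.ofReal_pow s.coe_nonneg, ← ENNReal.ofReal_mul hc0.le,
      mul_pow, mul_mul_mul_comm, ← pow_succ, Nat.sub_add_cancel hd]
  rw [hscale, mul_assoc] at hweak
  rwa [weakTypeConstant, ENNReal.ofReal_div_of_pos hc0, ENNReal.mul_comm_div, ← mul_div_assoc,
    ENNReal.le_div_iff_mul_le (.inl (ENNReal.ofReal_pos.2 hc0).ne') (.inl ENNReal.ofReal_ne_top),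
    mul_comm _ (ENNReal.ofReal c)]

end ShiftedGeodesic

end EnvironmentShift

section Normalized

variable {d : ℕ} {G : Measure ℝ} [IsProbabilityMeasure G] {a b α : ℝ}

lemma sq_mul_pow_mul_exp_pow_floor_log_le_one {c n : ℝ} (hc : 1 ≤ c) (hn : 1 ≤ n)
    (hcn : 5 ^ d * c ^ (d + 2) * Real.exp (d + 3) ≤ n) :
    (c * n) ^ 2 * ((2 * (⌈c * n⌉₊ : ℝ) + 1) ^ d * Real.exp (-(d + 3)) ^ ⌊Real.log n⌋₊) ≤ 1 := by
  have hn0 : 0 < n := by linarith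
  have hcn1 : 1 ≤ c * n := one_le_mul_of_one_le_of_one_le hc hn
  have hceil : 2 * (⌈c * n⌉₊ : ℝ) + 1 ≤ 5 * (c * n) := by
    linarith [Nat.ceil_lt_add_one (zero_le_one.trans hcn1)]
  have hexp : Real.exp (-(d + 3)) ^ ⌊Real.log n⌋₊ ≤ Real.exp (d + 3) / n ^ (d + 3) := by
    have hpow : n ^ (d + 3) = Real.exp ((d + 3) * Real.log n) := by
      rw [mul_comm, Real.exp_mul, Real.exp_log hn0]
      exact_mod_cast (Real.rpow_natCast n (d + 3)).symm
    rw [hpow, ← Real.exp_sub, ← Real.exp_nat_mul, Real.exp_le_exp]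
    have hfloor := mul_le_mul_of_nonneg_left (Nat.lt_floor_add_one (Real.log n)).le
      (by positivity : (0 : ℝ) ≤ d + 3)
    linarith
  calc (c * n) ^ 2 * ((2 * (⌈c * n⌉₊ : ℝ) + 1) ^ d * Real.exp (-(d + 3)) ^ ⌊Real.log n⌋₊)
      ≤ (c * n) ^ 2 * ((5 * (c * n)) ^ d * (Real.exp (d + 3) / n ^ (d + 3))) := by gcongr
    _ = (5 ^ d * c ^ (d + 2) * Real.exp (d + 3)) / n := by
        rw [mul_pow 5, mul_pow c n d]
        field_simp
        ring
    _ ≤ 1 := by rwa [div_le_one hn0]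

lemma sq_mul_environment_exceptionalEvent_le (hd : 1 ≤ d) {B : Set ℝ} (hB : MeasurableSet B)
    (hGB : G B ≤ ENNReal.ofReal (Real.exp (-(d + 3)) / (4 * d)) ^ 2) {c n : ℝ} (hc : 1 ≤ c)
    (hn : 1 ≤ n) (hcn : 5 ^ d * c ^ (d + 2) * Real.exp (d + 3) ≤ n) :
    ENNReal.ofReal (c * n) ^ 2 *
      environment d G (exceptionalEvent d B ⌊Real.log n⌋₊ ⌈c * n⌉₊) ≤ 1 := by
  have hd1 : (1 : ℝ) ≤ d := by exact_mod_cast hd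
  have hη : ENNReal.ofReal (Real.exp (-(d + 3)) / (4 * d)) ≤ 1 := by
    rw [ENNReal.ofReal_le_one, div_le_one (by positivity)]
    linarith [Real.exp_le_one_iff.2 (by linarith : -((d : ℝ) + 3) ≤ 0)]
  have hbase : 4 * d * ENNReal.ofReal (Real.exp (-(d + 3)) / (4 * d)) =
      ENNReal.ofReal (Real.exp (-(d + 3))) := by
    rw [← ENNReal.ofReal_natCast, ← ENNReal.ofReal_ofNat, ← ENNReal.ofReal_mul (by norm_num),
      ← ENNReal.ofReal_mul (by positivity), mul_div_cancel₀ _ (by positivity)]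
  have hcount : (2 * ⌈c * n⌉₊ + 1 : ℝ≥0∞) = ENNReal.ofReal (2 * ⌈c * n⌉₊ + 1) := by
    rw [← Nat.cast_ofNat, ← Nat.cast_mul, ← Nat.cast_add_one, ← ENNReal.ofReal_natCast]
    norm_cast
  refine (mul_le_mul_right (environment_exceptionalEvent_le hB hη hGB _ _) _).trans ?_
  rw [hbase, hcount, ← ENNReal.ofReal_pow (by positivity), ← ENNReal.ofReal_pow (by positivity),
    ← ENNReal.ofReal_pow (by positivity), ← ENNReal.ofReal_mul (by positivity),
    ← ENNReal.ofReal_mul (by positivity), ENNReal.ofReal_le_one]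
  exact sq_mul_pow_mul_exp_pow_floor_log_le_one hc hn hcn

lemma IsAdmissibleOn.ae_geodesicWeight_le (hG : IsAdmissibleOn G a b α) (ha : 0 < a)
    {q : Edge d → ℝ≥0} (hq : ∀ e, q e ≤ 1) (x y : Fin d → ℤ) :
    ∀ᵐ t ∂environment d G, geodesicWeight q x y t ≤ ENNReal.ofReal (b / a * l1dist x y) := by
  filter_upwards [hG.ae_exists_isGeodesic ha q x y] with t ⟨p, _, _, hlen, hweight⟩
  rw [hweight]
  refine ENNReal.ofReal_le_ofReal ?_
  calc passageTime (fun e => (q e : ℝ)) p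
      ≤ 1 * p.length := passageTime_le_mul_length (fun e => by exact_mod_cast hq e) p
    _ ≤ b / a * l1dist x y := by
        rwa [one_mul, div_mul_eq_mul_div, le_div_iff₀' ha]

lemma le_inv_sixteen_pow_of_pow_mul_le (hd : 2 ≤ d) {M : ℝ≥0} (hM : M ≠ 0) {k : ℕ} {x : ℝ≥0∞}
    (h : ((4 : ℝ≥0∞) ^ k * M) ^ d * x ≤ M ^ d) : x ≤ (16 ^ k)⁻¹ := by
  have hMd : (M : ℝ≥0∞) ^ d ≠ 0 := pow_ne_zero d (by exact_mod_cast hM)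
  rw [mul_pow, mul_comm (_ ^ d), mul_assoc] at h
  have h' : ((4 : ℝ≥0∞) ^ k) ^ d * x ≤ 1 :=
    (ENNReal.mul_le_mul_iff_right hMd (ENNReal.pow_ne_top ENNReal.coe_ne_top)).1 (by rwa [mul_one])
  rw [ENNReal.le_inv_iff_mul_le, mul_comm]
  calc (16 : ℝ≥0∞) ^ k * x = ((4 : ℝ≥0∞) ^ k) ^ 2 * x := by rw [pow_right_comm]; norm_num
    _ ≤ ((4 : ℝ≥0∞) ^ k) ^ d * x := by
        gcongr
        exact one_le_pow₀ (by norm_num)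
    _ ≤ 1 := h'

/-- A size from which on the exceptional event of scale `log n` is negligible. -/
noncomputable def sizeThreshold (d : ℕ) (a b : ℝ) : ℝ :=
  max 3 (5 ^ d * (b / a * d) ^ (d + 2) * Real.exp (d + 3))

lemma IsAdmissibleOn.lintegral_geodesicWeight_le (hG : IsAdmissibleOn G a b α) (ha : 0 < a)
    (hd : 2 ≤ d) {κ : ℝ} (hκ : 0 < κ) {B : Set ℝ} (hB : MeasurableSet B)
    (hGB : G B ≤ ENNReal.ofReal (Real.exp (-(d + 3)) / (4 * d)) ^ 2)
    (hκB : ∀ t ∈ Set.Icc a b, t ∉ B → ∀ τ, 0 ≤ τ → τ ≤ 1 → t + κ * τ ≤ siteShift G a b τ t)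
    {v : Fin d → ℤ} (hv : sizeThreshold d a b ≤ ‖toEuclid v‖) {q : Edge d → ℝ≥0}
    (hqv : IsLogSmooth ‖toEuclid v‖ q) (hq : ∑' e, (q e : ℝ≥0∞) ^ 2 ≤ (1 / 4 : ℝ≥0)) {M : ℝ≥0}
    (hM : 1 ≤ M)
    (hMd : ENNReal.ofReal (weakTypeConstant d a b α κ) * ∑' e, (q e : ℝ≥0∞) ≤ M ^ d) :
    ∫⁻ t, geodesicWeight q 0 v t ∂environment d G ≤ 20 * M := by
  set n : ℝ := ‖toEuclid v‖
  set c : ℝ := b / a * d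
  have hb : 0 < b := ha.trans hG.lt
  have hn3 : 3 ≤ n := (le_max_left _ _).trans hv
  have hc : 1 ≤ c := one_le_mul_of_one_le_of_one_le ((one_le_div ha).2 hG.lt.le)
    (by exact_mod_cast one_le_two.trans hd)
  have hq1 (e : Edge d) : q e ≤ 1 := (lt_one_of_tsum_sq_le hq e).le
  have hlog : 1 ≤ Real.log n := (Real.le_log_iff_exp_le (by linarith)).2
    (by linarith [Real.exp_one_lt_d9])
  have hLn : (⌊Real.log n⌋₊ : ℝ) ≤ Real.log n := Nat.floor_le (by linarith)
  have hlen : b / a * l1dist 0 v ≤ c * n :=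
    (mul_le_mul_of_nonneg_left (l1dist_zero_le v) (by positivity)).trans_eq (mul_assoc _ _ _).symm
  have hRv : b * l1dist 0 v ≤ a * ⌈c * n⌉₊ := by
    rw [← div_le_iff₀' ha, ← div_mul_eq_mul_div]
    exact hlen.trans (Nat.le_ceil _)
  obtain ⟨W, hW, hW3⟩ := hG.exists_isDensityTransport_envShift hq ⌈c * n⌉₊
  have hweight := measurable_geodesicWeight q 0 v
  rw [← hW.lintegral_mul_comp hweight]
  simp only [mul_comm (W _)]
  have hM0 : M ≠ 0 := (one_pos.trans_le hM).ne'
  refine lintegral_mul_le_of_weak_type (hweight.comp hW.measurable_map) hW.measurable_density hW3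
    (K := ENNReal.ofReal (c * n)) (by exact_mod_cast hM0) ENNReal.coe_ne_top
    (ENNReal.one_le_ofReal.2 (one_le_mul_of_one_le_of_one_le hc (by linarith)))
    ENNReal.ofReal_ne_top ?_ (sq_mul_environment_exceptionalEvent_le (one_le_two.trans hd) hB hGB
      hc (by linarith) ((le_max_right _ _).trans hv)) fun k => ?_
  · filter_upwards [hW.ae_comp (hG.ae_geodesicWeight_le ha hq1 0 v)] with t ht
    exact (ht.trans (ENNReal.ofReal_le_ofReal hlen)).trans
      (le_mul_of_one_le_right' (by exact_mod_cast hM))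
  · have hweak := hG.pow_mul_measure_envShift_le ha (one_le_two.trans hd) hκ hκB hq1 hqv hW
      (Nat.floor_pos.2 hlog) hLn (floor_log_norm_le_l1dist v) hRv (4 ^ k * M)
    push_cast at hweak
    exact le_inv_sixteen_pow_of_pow_mul_le hd hM0 (hweak.trans hMd)

lemma exists_one_le_pow_eq {x : ℝ≥0∞} (hx : 1 ≤ x) (hx' : x ≠ ⊤) (hd : d ≠ 0) :
    ∃ M : ℝ≥0, 1 ≤ M ∧ (M : ℝ≥0∞) ^ d = x := by
  lift x to ℝ≥0 using hx'
  exact ⟨x ^ (d : ℝ)⁻¹, NNReal.one_le_rpow (by exact_mod_cast hx) (by positivity),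
    by exact_mod_cast NNReal.rpow_inv_natCast_pow x hd⟩

lemma IsAdmissible.exists_lintegral_geodesicWeight_pow_le_of_tsum_sq_eq (hG : IsAdmissible G)
    (hd : 2 ≤ d) :
    ∃ (C : ℝ≥0) (n₀ : ℝ), C ≠ 0 ∧ ∀ v : Fin d → ℤ, n₀ ≤ ‖toEuclid v‖ →
      ∀ q : Edge d → ℝ≥0, IsLogSmooth ‖toEuclid v‖ q →
        ∑' e, (q e : ℝ≥0∞) ^ 2 = (1 / 4 : ℝ≥0) →
          (∫⁻ t, geodesicWeight q 0 v t ∂environment d G) ^ d ≤ C * ∑' e, (q e : ℝ≥0∞) := by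
  obtain ⟨a, b, α, ha, hG⟩ := hG.exists_isAdmissibleOn
  have : (0 : ℝ) < d := by exact_mod_cast two_pos.trans_le hd
  obtain ⟨κ, B, hκ, hB, hGB, hκB⟩ := hG.exists_add_mul_le_siteShift
    (ε := ENNReal.ofReal (Real.exp (-(d + 3)) / (4 * d)) ^ 2)
    (ENNReal.pow_pos (ENNReal.ofReal_pos.2 (by positivity)) 2)
  set c : ℝ≥0 := max 4 (weakTypeConstant d a b α κ).toNNReal
  refine ⟨20 ^ d * c, sizeThreshold d a b, by positivity, fun v hv q hqv hq => ?_⟩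
  rcases eq_or_ne (∑' e, (q e : ℝ≥0∞)) ⊤ with hσ | hσ
  · rw [hσ, ENNReal.mul_top (by positivity)]
    exact le_top
  have hsq : ∑' e, (q e : ℝ≥0∞) ^ 2 ≤ ∑' e, (q e : ℝ≥0∞) :=
    ENNReal.tsum_le_tsum fun e => pow_le_of_le_one zero_le
      (by exact_mod_cast (lt_one_of_tsum_sq_le hq.le e).le) two_ne_zero
  have hcσ : 1 ≤ c * ∑' e, (q e : ℝ≥0∞) :=
    calc (1 : ℝ≥0∞) = (4 * (1 / 4) : ℝ≥0) := by norm_num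
      _ ≤ c * ∑' e, (q e : ℝ≥0∞) := by
        rw [ENNReal.coe_mul, ← hq]
        exact mul_le_mul' (by exact_mod_cast le_max_left _ _) hsq
  obtain ⟨M, hM, hMd⟩ :=
    exists_one_le_pow_eq hcσ (ENNReal.mul_ne_top ENNReal.coe_ne_top hσ) (by omega : d ≠ 0)
  have hbound := hG.lintegral_geodesicWeight_le ha hd hκ hB hGB hκB hv hqv hq.le hM
    (hMd ▸ mul_le_mul_left (ENNReal.coe_le_coe.2 (le_max_right _ _)) _)
  calc (∫⁻ t, geodesicWeight q 0 v t ∂environment d G) ^ d ≤ (20 * M) ^ d := by gcongr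
    _ = (20 ^ d * c : ℝ≥0) * ∑' e, (q e : ℝ≥0∞) := by
        rw [mul_pow, hMd, ← mul_assoc]
        norm_cast

end Normalized

section Homogeneity

variable {d : ℕ}

lemma IsLogSmooth.const_mul {n : ℝ} {q : Edge d → ℝ≥0} (hq : IsLogSmooth n q) (c : ℝ≥0) :
    IsLogSmooth n fun e => c * q e := by
  intro e e' h
  rw [mul_left_comm _ c, mul_left_comm _ c]
  exact ⟨mul_le_mul_right (hq e e' h).1 c, mul_le_mul_right (hq e e' h).2 c⟩

lemma geodesicWeight_const_mul (c : ℝ≥0) (q : Edge d → ℝ≥0) (x y : Fin d → ℤ)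
    (t : Edge d → ℝ) :
    geodesicWeight (fun e => c * q e) x y t = c * geodesicWeight q x y t := by
  simp only [geodesicWeight, ENNReal.coe_mul, ENNReal.tsum_mul_left]

lemma pow_le_of_normalized (hd : 1 ≤ d) {I S σ : ℝ≥0∞} {C : ℝ≥0} (hS : S ≠ 0) (hS' : S ≠ ⊤)
    (h : ∀ c : ℝ≥0, c ^ 2 * S = (1 / 4 : ℝ≥0) → (c * I) ^ d ≤ C * (c * σ)) :
    I ^ d ≤ (C * 2 ^ (d - 1) : ℝ≥0) * S ^ (((d : ℝ) - 1) / 2) * σ := by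
  lift S to ℝ≥0 using hS'
  have hS0 : S ≠ 0 := by exact_mod_cast hS
  set r : ℝ≥0 := NNReal.sqrt S with hr
  have hr0 : r ≠ 0 := by simpa [hr] using hS0
  have hrpow : (S : ℝ≥0∞) ^ (((d : ℝ) - 1) / 2) = (r : ℝ≥0∞) ^ (d - 1) := by
    rw [← ENNReal.coe_rpow_of_ne_zero hS0, hr, NNReal.sqrt_eq_rpow, ← ENNReal.coe_pow,
      ← NNReal.rpow_natCast, ← NNReal.rpow_mul, Nat.cast_sub hd, Nat.cast_one, div_eq_inv_mul,
      one_div]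
  have hc : ((2 * r)⁻¹ : ℝ≥0) ^ 2 * S = 1 / 4 := by
    rw [← NNReal.sq_sqrt S, ← hr]
    field_simp
    norm_num
  have hcancel : ((2 * r : ℝ≥0) : ℝ≥0∞) * ((2 * r)⁻¹ : ℝ≥0) = 1 := by
    rw [← ENNReal.coe_mul, mul_inv_cancel₀ (by positivity), ENNReal.coe_one]
  calc I ^ d = (2 * r : ℝ≥0) ^ d * (((2 * r)⁻¹ : ℝ≥0) * I) ^ d := by
        rw [← mul_pow, ← mul_assoc, hcancel, one_mul]
    _ ≤ (2 * r : ℝ≥0) ^ d * (C * (((2 * r)⁻¹ : ℝ≥0) * σ)) := by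
        gcongr
        exact h _ (by exact_mod_cast hc)
    _ = C * (2 * r : ℝ≥0) ^ (d - 1) * ((2 * r : ℝ≥0) * ((2 * r)⁻¹ : ℝ≥0)) * σ := by
        rw [← pow_sub_one_mul (by omega : d ≠ 0)]
        ring
    _ = (C * 2 ^ (d - 1) : ℝ≥0) * S ^ (((d : ℝ) - 1) / 2) * σ := by
        rw [hcancel, hrpow, mul_one]
        push_cast
        ring

lemma IsAdmissible.exists_lintegral_geodesicWeight_pow_le {G : Measure ℝ}
    [IsProbabilityMeasure G] (hG : IsAdmissible G) (hd : 2 ≤ d) :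
    ∃ (C : ℝ≥0) (n₀ : ℝ), ∀ v : Fin d → ℤ, n₀ ≤ ‖toEuclid v‖ →
      ∀ q : Edge d → ℝ≥0, IsLogSmooth ‖toEuclid v‖ q →
        (∫⁻ t, geodesicWeight q 0 v t ∂environment d G) ^ d ≤
          C * (∑' e, (q e : ℝ≥0∞) ^ 2) ^ (((d : ℝ) - 1) / 2) * ∑' e, (q e : ℝ≥0∞) := by
  obtain ⟨C, n₀, hC, h⟩ := hG.exists_lintegral_geodesicWeight_pow_le_of_tsum_sq_eq hd
  refine ⟨C * 2 ^ (d - 1), n₀, fun v hv q hq => ?_⟩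
  have hd1 : (1 : ℝ) < d := by exact_mod_cast hd
  by_cases hq0 : ∀ e, q e = 0
  · simp [geodesicWeight, hq0, (two_pos.trans_le hd).ne']
  have hsum0 : ∑' e, (q e : ℝ≥0∞) ≠ 0 := by simpa [ENNReal.tsum_eq_zero] using hq0
  have hS0 : ∑' e, (q e : ℝ≥0∞) ^ 2 ≠ 0 := by simpa [ENNReal.tsum_eq_zero] using hq0
  rcases eq_or_ne (∑' e, (q e : ℝ≥0∞) ^ 2) ⊤ with hS | hS
  · rw [hS, ENNReal.top_rpow_of_pos (by linarith), ENNReal.mul_top (by positivity),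
      ENNReal.top_mul hsum0]
    exact le_top
  · refine pow_le_of_normalized (one_le_two.trans hd) hS0 hS fun c hc => ?_
    have hscaled := h v hv _ (hq.const_mul c)
      (by simpa only [ENNReal.coe_mul, mul_pow, ENNReal.tsum_mul_left] using hc)
    simpa only [geodesicWeight_const_mul, ENNReal.coe_mul, ENNReal.tsum_mul_left,
      lintegral_const_mul c (measurable_geodesicWeight q 0 v)] using hscaled

end Homogeneity

end FPP

theorem proposition4p1 (d : ℕ) (hd : 2 ≤ d) (G : Measure ℝ) [IsProbabilityMeasure G]
    (hG : FPP.IsAdmissible G) :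
    ∃ (C : ℝ≥0) (n₀ : ℝ), ∀ (Ω : Type*) [MeasurableSpace Ω] (P : Measure Ω)
      [IsProbabilityMeasure P] (t : FPP.Edge d → Ω → ℝ), FPP.IsIIDEnvironment P t G →
      ∀ v : Fin d → ℤ, n₀ ≤ ‖FPP.toEuclid v‖ →
      ∀ q : FPP.Edge d → ℝ≥0, FPP.IsLogSmooth ‖FPP.toEuclid v‖ q →
        (∑' e, (q e : ℝ≥0∞) * FPP.geodesicProb P t v e) ^ d ≤
          (C : ℝ≥0∞) * (∑' e, (q e : ℝ≥0∞) ^ 2) ^ (((d : ℝ) - 1) / 2) * ∑' e, (q e : ℝ≥0∞) := by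
  obtain ⟨C, n₀, h⟩ := hG.exists_lintegral_geodesicWeight_pow_le hd
  refine ⟨C, n₀, fun Ω _ P _ t ht v hv q hq => ?_⟩
  simp only [ht.geodesicProb_eq, ← FPP.lintegral_geodesicWeight]
  exact h v hv q hq
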